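/- For a real number $z$ and an integer $j\ge 0$ put $\binom{z}{j}:=\frac{z(z-1)\cdots(z-j+1)}{j!}$. For a finite family $\mathcal F$ of $k$-element sets let $\partial\mathcal F$ be its immediate shadow, i.e. the family of all $(k-1)$-element sets contained in at least one member of $\mathcal F$, and, for an integer $n$, let $$\gamma_{KK}(\mathcal F,n):=\min_{X,\ |X|=n}\Big|\mathcal F\setminus\binom{X}{k}\Big|$$ be its Kruskal--Katona diversity, where $\binom{X}{k}$ denotes the family of all $k$-element subsets of $X$. **Theorem.** Let $n>k>0$ be integers and let $\mathcal F$ be a finite family of $k$-element sets. Suppose that for some real numbers $x,y$ with $k-1\le x\le n-3$ and $n-k\le y\le n-3$ we have $$|\mathcal F|\ \ge\ \binom{n}{k}-\binom{y}{n-k}+\binom{x}{k-1}\qquad\text{and}\qquad \gamma_{KK}(\mathcal F,n)\ \ge\ \binom{x}{k-1}.$$ Then $$|\partial\mathcal F|\ \ge\ \binom{n}{k-1}-\binom{y}{n-k+1}+\binom{x}{k-2}.$$ (The conditions on $x$ and $y$ force $3\le k\le n-2$, so all lower indices are positive.) -/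

import Mathlib

/-- The Kruskal–Katona diversity `γ_KK(F, n)` of a family `F` of `k`-element sets: the minimum,
over all `n`-element sets `X`, of the number of members of `F` that are not `k`-subsets of `X`.
(If the ground type has fewer than `n` elements the value is `0`, in accordance with the value
obtained after enlarging the ground set.) -/
noncomputable def kruskalKatonaDiversity {α : Type*} [DecidableEq α]
    (k : ℕ) (F : Finset (Finset α)) (n : ℕ) : ℕ :=
  sInf {d : ℕ | ∃ X : Finset α, X.card = n ∧ d = (F \ X.powersetCard k).card}

/-! Write k = l + 3, n = l + i + 5, and put q = C(x,k-1), L = C(x,k-2), p = C(n-1,k-1) - C(y,n-k), D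
= C(n-1,k-2) - C(y,n-k+1). By Pascal's rule the hypothesis reads |F| ≥ C(n-1,k) + p + q, and the
claim |∂F| ≥ C(n-1,k-1) + D + L. Let H be the concave function that is linear from (0,0) to (q,L)
and from there to (p,D), and constant afterwards. Lovász's form of Kruskal–Katona, used directly for
small families and through complements in an (n-1)-set for large ones, gives |∂G| ≥ H(|G|) for every
(k-1)-uniform G (`exists_shadowProfile`).

If enough of F lies in one n-set X, the shadow has at least C(n-1,k-1) + H(|F inside X| - C(n-1,k))
sets inside X and at least H(|F outside X|) sets not inside it. Diversity makes the outside part at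
least q, and concavity then yields D + L (`le_card_shadow_of_inside`).

Other families are treated by induction on a colex weight, applying a smallest (U,V)-compression
that moves F, so that the shadow does not grow. A family fixed by all compressions is a colex
initial segment, and the one-set bound applies. The obstruction is that a compression may destroy
diversity, leaving fewer than q members outside some n-set X. If |U| ≥ 2, few members have just
entered X, so F was already concentrated on X. If U = {u} and V = {v}, then F is concentrated on two
n-sets Z ∪ {u} and Z ∪ {v}, which needs a separate count (`le_card_shadow_of_two_centres`). -/

namespace Ring

open Finset

/-! ### Binomial coefficients of a real argument: monotonicity and log-concavity. -/

lemma real_choose_eq_prod (x : ℝ) (j : ℕ) :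
    Ring.choose x j = (∏ t ∈ range j, (x - t)) / (j.factorial : ℝ) := by
  induction j with
  | zero => simp
  | succ j ih =>
    have h1 := Ring.descPochhammer_eq_factorial_smul_choose x (j + 1)
    have h0 := Ring.descPochhammer_eq_factorial_smul_choose x j
    have hf : ((j + 1).factorial : ℝ) ≠ 0 := by positivity
    have hf0 : (j.factorial : ℝ) ≠ 0 := by positivity
    rw [descPochhammer_succ_right, Polynomial.smeval_mul] at h1
    rw [h0] at h1
    simp only [nsmul_eq_mul, Polynomial.smeval_sub, Polynomial.smeval_X, Polynomial.smeval_natCast,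
      pow_one, pow_zero, mul_one] at h1
    rw [eq_div_iff hf, prod_range_succ, mul_comm, ← h1, ih]
    field_simp

lemma real_choose_succ_mul (x : ℝ) (j : ℕ) :
    Ring.choose x (j + 1) * (j + 1) = Ring.choose x j * (x - j) := by
  rw [real_choose_eq_prod, real_choose_eq_prod, prod_range_succ, Nat.factorial_succ]
  push_cast
  field_simp

lemma real_choose_nonneg {x : ℝ} {j : ℕ} (h : (j : ℝ) - 1 ≤ x) : 0 ≤ Ring.choose x j := by
  rw [real_choose_eq_prod]
  refine div_nonneg (prod_nonneg fun t ht => ?_) (by positivity)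
  have : (t : ℝ) + 1 ≤ j := by exact_mod_cast mem_range.1 ht
  linarith

lemma real_choose_pos {x : ℝ} {j : ℕ} (h : (j : ℝ) - 1 < x) : 0 < Ring.choose x j := by
  rw [real_choose_eq_prod]
  refine div_pos (prod_pos fun t ht => ?_) (by positivity)
  have : (t : ℝ) + 1 ≤ j := by exact_mod_cast mem_range.1 ht
  linarith

lemma real_choose_mono {x y : ℝ} {j : ℕ} (h : (j : ℝ) - 1 ≤ x) (hxy : x ≤ y) :
    Ring.choose x j ≤ Ring.choose y j := by
  rw [real_choose_eq_prod, real_choose_eq_prod]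
  gcongr with t ht
  intro t ht
  have : (t : ℝ) + 1 ≤ j := by exact_mod_cast mem_range.1 ht
  linarith

lemma real_choose_strictMono {x y : ℝ} {j : ℕ} (h : (j : ℝ) ≤ x) (hxy : x < y) :
    Ring.choose x (j + 1) < Ring.choose y (j + 1) := by
  have h1 := real_choose_succ_mul x j
  have h2 := real_choose_succ_mul y j
  have h3 : Ring.choose x j ≤ Ring.choose y j := real_choose_mono (by linarith) hxy.le
  have h4 : 0 < Ring.choose y j := real_choose_pos (by linarith)
  have h5 : Ring.choose x j * (x - j) < Ring.choose y j * (y - j) :=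
    mul_lt_mul' h3 (by linarith) (by linarith) h4
  have h6 : (0 : ℝ) < j + 1 := by positivity
  nlinarith

lemma real_choose_continuous (j : ℕ) : Continuous fun x : ℝ => Ring.choose x j := by
  simp only [real_choose_eq_prod]
  fun_prop

lemma exists_real_choose_eq {v : ℝ} (hv : 1 ≤ v) (j : ℕ) :
    ∃ x : ℝ, ((j + 1 : ℕ) : ℝ) ≤ x ∧ Ring.choose x (j + 1) = v := by
  obtain ⟨M, hM⟩ := exists_nat_ge v
  have hlow : Ring.choose ((j + 1 : ℕ) : ℝ) (j + 1) ≤ v := by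
    rw [Ring.choose_natCast]; simpa using hv
  have hup : v ≤ Ring.choose ((j + 1 + M : ℕ) : ℝ) (j + 1) := by
    rw [Ring.choose_natCast]
    refine hM.trans ?_
    norm_cast
    clear hM
    induction M with
    | zero => simp
    | succ M ih =>
      rw [← add_assoc, Nat.choose_succ_succ, Nat.succ_eq_add_one]
      have : 0 < (j + 1 + M).choose j := Nat.choose_pos (by omega)
      omega
  obtain ⟨x, hx, hxv⟩ := intermediate_value_Icc (a := ((j + 1 : ℕ) : ℝ))
    (b := ((j + 1 + M : ℕ) : ℝ)) (by push_cast; linarith [M.cast_nonneg (α := ℝ)])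
    (real_choose_continuous (j + 1)).continuousOn ⟨hlow, hup⟩
  exact ⟨x, hx.1, hxv⟩

/-- Log-concavity: every factor of the product is affine, and weighted AM–GM is applied factor by
factor. -/
lemma real_choose_geom_mean_le {u w t A B : ℝ} {j : ℕ} (hu : (j : ℝ) - 1 ≤ u)
    (hw : (j : ℝ) - 1 ≤ w) (hAu : 0 ≤ A - B * u) (hAw : 0 ≤ A - B * w) (h0 : 0 ≤ t) (h1 : t ≤ 1) :
    (Ring.choose u j * (A - B * u)) ^ (1 - t) * (Ring.choose w j * (A - B * w)) ^ t ≤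
      Ring.choose ((1 - t) * u + t * w) j * (A - B * ((1 - t) * u + t * w)) := by
  have key : ∀ p q : ℝ, 0 ≤ p → 0 ≤ q → p ^ (1 - t) * q ^ t ≤ (1 - t) * p + t * q :=
    fun p q hp hq => Real.geom_mean_le_arith_mean2_weighted (by linarith) h0 hp hq (by ring)
  have pos : ∀ z : ℝ, (j : ℝ) - 1 ≤ z → ∀ s ∈ range j, 0 ≤ z - (s : ℝ) := by
    intro z hz s hs
    have : (s : ℝ) + 1 ≤ j := by exact_mod_cast mem_range.1 hs
    linarith
  have hch : (Ring.choose u j) ^ (1 - t) * (Ring.choose w j) ^ t ≤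
      Ring.choose ((1 - t) * u + t * w) j := by
    have hf : (0 : ℝ) ≤ j.factorial := by positivity
    have hf' : (0 : ℝ) < j.factorial := by positivity
    rw [real_choose_eq_prod, real_choose_eq_prod, real_choose_eq_prod,
      Real.div_rpow (prod_nonneg (pos u hu)) hf, Real.div_rpow (prod_nonneg (pos w hw)) hf,
      div_mul_div_comm, ← Real.rpow_add hf', sub_add_cancel, Real.rpow_one]
    gcongr
    rw [← Real.finsetProd_rpow _ _ (pos u hu), ← Real.finsetProd_rpow _ _ (pos w hw),
      ← prod_mul_distrib]
    refine prod_le_prod (fun s hs => ?_) (fun s hs => ?_)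
    · exact mul_nonneg (Real.rpow_nonneg (pos u hu s hs) _) (Real.rpow_nonneg (pos w hw s hs) _)
    · refine (key _ _ (pos u hu s hs) (pos w hw s hs)).trans_eq ?_
      ring
  rw [Real.mul_rpow (real_choose_nonneg hu) hAu, Real.mul_rpow (real_choose_nonneg hw) hAw]
  have h2 := key _ _ hAu hAw
  have h3 : (1 - t) * (A - B * u) + t * (A - B * w) = A - B * ((1 - t) * u + t * w) := by ring
  rw [h3] at h2
  calc _ = ((Ring.choose u j) ^ (1 - t) * (Ring.choose w j) ^ t) *
        ((A - B * u) ^ (1 - t) * (A - B * w) ^ t) := by ring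
    _ ≤ _ := by
      refine mul_le_mul hch h2 (mul_nonneg (Real.rpow_nonneg hAu _) (Real.rpow_nonneg hAw _)) ?_
      refine real_choose_nonneg ?_
      nlinarith

/-- A log-concave function has no interior dip. If `A - B * u` is negative, the product is
nonincreasing from `u` on, so the hypothesis forces equality. -/
lemma real_choose_mul_affine_le {u v w A B : ℝ} {j : ℕ} (hB : 0 ≤ B) (hu : (j : ℝ) - 1 < u)
    (huv : u ≤ v) (hvw : v ≤ w)
    (h : Ring.choose u j * (A - B * u) ≤ Ring.choose w j * (A - B * w)) :
    Ring.choose u j * (A - B * u) ≤ Ring.choose v j * (A - B * v) := by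
  rcases huv.eq_or_lt with rfl | huv'
  · exact le_rfl
  have huw : u < w := by linarith
  have hcu := real_choose_pos hu
  have hcw : 0 < Ring.choose w j := real_choose_pos (by linarith)
  rcases lt_or_ge (A - B * u) 0 with hneg | hpos
  · have h1 : Ring.choose u j ≤ Ring.choose v j := real_choose_mono hu.le huv
    have h2 : Ring.choose v j ≤ Ring.choose w j := real_choose_mono (by linarith) hvw
    have h3 : A - B * w ≤ A - B * v := by nlinarith
    have h4 : A - B * v ≤ A - B * u := by nlinarith
    have h5 : A - B * u ≤ A - B * w := by
      refine le_of_mul_le_mul_left (le_trans ?_ h) hcw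
      nlinarith
    have h6 : Ring.choose w j ≤ Ring.choose u j := by nlinarith
    rw [le_antisymm (h2.trans h6) h1, le_antisymm h4 (h5.trans h3)]
  · have hpw : 0 ≤ A - B * w := by
      have : 0 ≤ Ring.choose w j * (A - B * w) := (mul_nonneg hcu.le hpos).trans h
      exact nonneg_of_mul_nonneg_right this hcw
    set t := (v - u) / (w - u) with ht
    have hd : 0 < w - u := by linarith
    have ht0 : 0 ≤ t := div_nonneg (by linarith) hd.le
    have ht1 : t ≤ 1 := (div_le_one hd).2 (by linarith)
    have hv : (1 - t) * u + t * w = v := by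
      rw [ht]; field_simp; ring
    have := real_choose_geom_mean_le (j := j) hu.le (by linarith) hpos hpw ht0 ht1
    rw [hv] at this
    refine le_trans ?_ this
    set gu := Ring.choose u j * (A - B * u)
    have hgu : 0 ≤ gu := mul_nonneg hcu.le hpos
    calc gu = gu ^ (1 - t) * gu ^ t := by
          rw [← Real.rpow_add' hgu (by simp)]; simp
      _ ≤ _ := by gcongr

/-- A positive log-concave function that does not drop from `v` to `w` cannot have dropped before
`v`. -/
lemma real_choose_mul_affine_le_of_le {u v w A B : ℝ} {j : ℕ} (hB : 0 ≤ B) (hu : (j : ℝ) - 1 < u)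
    (huv : u ≤ v) (hvw : v < w) (hw : 0 < A - B * w)
    (h : Ring.choose v j * (A - B * v) ≤ Ring.choose w j * (A - B * w)) :
    Ring.choose u j * (A - B * u) ≤ Ring.choose v j * (A - B * v) := by
  have huw : u < w := by linarith
  have hpv : 0 < A - B * v := by nlinarith
  have hpu : 0 < A - B * u := by nlinarith
  have hcv : 0 < Ring.choose v j := real_choose_pos (by linarith)
  have hcu : 0 < Ring.choose u j := real_choose_pos (by linarith)
  set t := (v - u) / (w - u) with ht
  have hd : 0 < w - u := by linarith
  have ht0 : 0 ≤ t := div_nonneg (by linarith) hd.le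
  have ht1 : t < 1 := (div_lt_one hd).2 (by linarith)
  have hv : (1 - t) * u + t * w = v := by
    rw [ht]; field_simp; ring
  have := real_choose_geom_mean_le (j := j) hu.le (by linarith) hpu.le hw.le ht0 ht1.le
  rw [hv] at this
  set gu := Ring.choose u j * (A - B * u)
  set gv := Ring.choose v j * (A - B * v)
  have hgu : 0 < gu := mul_pos hcu hpu
  have hgv : 0 < gv := mul_pos hcv hpv
  have h2 : gu ^ (1 - t) * gv ^ t ≤ gv ^ (1 - t) * gv ^ t := by
    calc _ ≤ gu ^ (1 - t) * (Ring.choose w j * (A - B * w)) ^ t := by gcongr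
      _ ≤ gv := this
      _ = _ := by rw [← Real.rpow_add hgv]; simp
  have h3 := le_of_mul_le_mul_right h2 (Real.rpow_pos_of_pos hgv _)
  exact (Real.rpow_le_rpow_iff hgu.le hgv.le (by linarith)).1 h3

end Ring

/-! ### Lovász's form of Kruskal–Katona and its complementary version. -/

namespace Finset

open scoped FinsetFamily

lemma card_memberSubfamily_le_shadow {α : Type*} [DecidableEq α] (v : α)
    (C : Finset (Finset α)) :
    #(C.memberSubfamily v) ≤ #((∂ C).nonMemberSubfamily v) := by
  refine card_le_card fun T hT => ?_
  rw [mem_memberSubfamily] at hT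
  rw [mem_nonMemberSubfamily, mem_shadow_iff_insert_mem]
  exact ⟨⟨v, hT.2, hT.1⟩, hT.2⟩

lemma shadow_memberSubfamily_subset {α : Type*} [DecidableEq α] (v : α)
    (C : Finset (Finset α)) :
    ∂ (C.memberSubfamily v) ⊆ (∂ C).memberSubfamily v := by
  intro T hT
  obtain ⟨a, ha, hT⟩ := mem_shadow_iff_insert_mem.1 hT
  rw [mem_memberSubfamily] at hT
  have hvT : v ∉ T := fun h => hT.2 (mem_insert_of_mem h)
  have hva : v ≠ a := fun h => hT.2 (h ▸ mem_insert_self a T)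
  rw [mem_memberSubfamily, mem_shadow_iff_insert_mem]
  refine ⟨⟨a, by simp [ha, Ne.symm hva], ?_⟩, hvT⟩
  rw [insert_comm]
  exact hT.1

lemma sized_memberSubfamily {α : Type*} [DecidableEq α] {v : α} {C : Finset (Finset α)} {r : ℕ}
    (hC : (C : Set (Finset α)).Sized (r + 1)) :
    ((C.memberSubfamily v : Finset (Finset α)) : Set (Finset α)).Sized r := by
  intro T hT
  rw [mem_coe, mem_memberSubfamily] at hT
  have := hC hT.1
  rw [card_insert_of_notMem hT.2] at this
  omega

lemma le_card_shadow_of_nonempty {α : Type*} [DecidableEq α] {C : Finset (Finset α)} {r : ℕ}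
    (hC : (C : Set (Finset α)).Sized r) (hne : C.Nonempty) : r ≤ #(∂ C) := by
  obtain ⟨S, hS⟩ := hne
  rw [← hC hS]
  refine card_le_card_of_injOn (fun a => S.erase a) (fun a ha => erase_mem_shadow hS ha) ?_
  intro a ha b hb hab
  by_contra hne
  have : a ∈ S.erase b := mem_erase.2 ⟨hne, ha⟩
  simp only at hab
  rw [← hab] at this
  exact notMem_erase a S this

variable {N : ℕ}

lemma exists_isInitSeg_card {r g : ℕ} (hg : g ≤ N.choose r) :
    ∃ C : Finset (Finset (Fin N)), Colex.IsInitSeg C r ∧ #C = g := by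
  induction g with
  | zero => exact ⟨∅, Colex.isInitSeg_empty, rfl⟩
  | succ g ih =>
    obtain ⟨C, hC, hCg⟩ := ih (by omega)
    have hne : ((univ : Finset (Fin N)).powersetCard r \ C).Nonempty := by
      rw [← card_pos]
      have := le_card_sdiff C ((univ : Finset (Fin N)).powersetCard r)
      rw [card_powersetCard, card_univ, Fintype.card_fin] at this
      omega
    obtain ⟨S, hS, hmin⟩ := exists_min_image _ (fun S => toColex S) hne
    simp only [mem_sdiff, mem_powersetCard, subset_univ, true_and] at hS hmin
    refine ⟨insert S C, ⟨?_, ?_⟩, by rw [card_insert_of_notMem hS.2, hCg]⟩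
    · intro T hT
      rcases mem_insert.1 (mem_coe.1 hT) with rfl | hT
      · exact hS.1
      · exact hC.1 hT
    · rintro s t hs ⟨hts, htr⟩
      rcases mem_insert.1 hs with rfl | hs
      · by_contra htC
        rw [mem_insert, not_or] at htC
        exact absurd hts (not_lt.2 (hmin t ⟨htr, htC.2⟩))
      · exact mem_insert_of_mem (hC.2 hs ⟨hts, htr⟩)

lemma toColex_insert_erase_lt {α : Type*} [LinearOrder α] {S : Finset α} {y z : α} (hz : z ∈ S)
    (hy : y ∉ S) (hyz : y < z) : toColex (insert y (S.erase z)) < toColex S := by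
  rw [Colex.lt_iff_exists_filter_lt]
  refine ⟨z, by simp [hz, hyz.ne'], ?_⟩
  ext a
  simp only [mem_filter, mem_insert, mem_erase]
  constructor
  · rintro ⟨rfl | ⟨_, h⟩, h2⟩
    · exact absurd h2 hyz.not_gt
    · exact ⟨h, h2⟩
  · rintro ⟨h, h2⟩
    exact ⟨Or.inr ⟨h2.ne', h⟩, h2⟩

/-- The real-variable form of the Kruskal–Katona theorem due to Lovász. -/
theorem real_choose_le_card_shadow {r : ℕ} {G : Finset (Finset (Fin N))} {x : ℝ}
    (hG : (G : Set (Finset (Fin N))).Sized (r + 1)) (hne : G.Nonempty) (hx : (r : ℝ) ≤ x)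
    (hcard : Ring.choose x (r + 1) ≤ #G) : Ring.choose x r ≤ #(∂ G) := by
  induction r generalizing G x with
  | zero =>
    have := le_card_shadow_of_nonempty hG hne
    rw [Ring.choose_zero_right]
    exact_mod_cast this
  | succ r ihr =>
    induction hg : #G using Nat.strong_induction_on generalizing G x with
    | _ g ihg =>
    -- The recursion to `x - 1` needs `r + 2 ≤ x`; below that, the shadow of a single member
    -- suffices.
    rcases le_or_gt x ((r + 1 + 1 : ℕ) : ℝ) with hxr | hxr
    · have h1 := le_card_shadow_of_nonempty hG hne
      have h2 : Ring.choose x (r + 1) ≤ Ring.choose ((r + 1 + 1 : ℕ) : ℝ) (r + 1) :=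
        Ring.real_choose_mono (by push_cast at hx ⊢; linarith) hxr
      rw [Ring.choose_natCast, Nat.choose_succ_self_right] at h2
      refine h2.trans ?_
      exact_mod_cast h1
    have hgN : #G ≤ N.choose (r + 1 + 1) := by
      simpa using hG.card_le
    obtain ⟨C, hC, hCg⟩ := exists_isInitSeg_card hgN
    refine le_trans ?_ (Nat.cast_le.2 (kruskal_katona hG hCg.le hC))
    rw [← hCg] at hcard hg
    have hCne : C.Nonempty := by rw [← card_pos, hCg]; exact card_pos.2 hne
    have hN : 0 < N := by
      by_contra h0
      obtain ⟨S, hS⟩ := hCne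
      have h1 := hC.1 hS
      have h2 := card_le_univ S
      rw [Fintype.card_fin] at h2
      omega
    set v : Fin N := ⟨0, hN⟩ with hv
    -- A colex initial segment is stable under replacing any element by the least point `v`.
    have hshift : ∂ (C.nonMemberSubfamily v) ⊆ C.memberSubfamily v := by
      intro T hT
      obtain ⟨a, ha, hT⟩ := mem_shadow_iff_insert_mem.1 hT
      rw [mem_nonMemberSubfamily] at hT
      have hvT : v ∉ T := fun h => hT.2 (mem_insert_of_mem h)
      have hva : v ≠ a := fun h => hT.2 (h ▸ mem_insert_self a T)
      rw [mem_memberSubfamily]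
      refine ⟨hC.2 hT.1 ⟨?_, ?_⟩, hvT⟩
      · have hlt : v < a := lt_of_le_of_ne (by simp [hv, Fin.le_def]) hva
        have := toColex_insert_erase_lt (mem_insert_self a T) hT.2 hlt
        rwa [erase_insert ha] at this
      · rw [card_insert_of_notMem hvT, ← hC.1 hT.1, card_insert_of_notMem ha]
    have hsplit := card_memberSubfamily_add_card_nonMemberSubfamily v C
    have hsplit' := card_memberSubfamily_add_card_nonMemberSubfamily v (∂ C)
    have hn : #(∂ (C.memberSubfamily v)) ≤ #((∂ C).memberSubfamily v) :=
      card_le_card (shadow_memberSubfamily_subset v C)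
    have hm := card_memberSubfamily_le_shadow v C
    have hnon : ((C.nonMemberSubfamily v : Finset (Finset (Fin N))) : Set _).Sized (r + 1 + 1) :=
      fun T hT => hC.1 (mem_nonMemberSubfamily.1 (mem_coe.1 hT)).1
    have hpascal := Ring.choose_succ_succ (x - 1) (r + 1)
    have hpascal' := Ring.choose_succ_succ (x - 1) r
    rw [sub_add_cancel] at hpascal hpascal'
    have hmempos : (C.memberSubfamily v).Nonempty := by
      by_contra h0
      rw [not_nonempty_iff_eq_empty] at h0
      have h1 : (C.nonMemberSubfamily v).Nonempty := by
        rw [← card_pos]; rw [h0, card_empty] at hsplit; have := card_pos.2 hCne; omega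
      have h2 := le_card_shadow_of_nonempty hnon h1
      have h3 := card_le_card hshift
      rw [h0, card_empty] at h3
      omega
    push_cast at hxr hx
    -- Otherwise more than C(x-1,r+2) members avoid `v`; by induction their shadow, which lies in
    -- the link of `v`, already has C(x-1,r+1) sets.
    have hmem : Ring.choose (x - 1) (r + 1) ≤ #(C.memberSubfamily v) := by
      by_contra hlt
      push Not at hlt
      have h1 : Ring.choose (x - 1) (r + 1 + 1) < #(C.nonMemberSubfamily v) := by
        have : (#(C.memberSubfamily v) : ℝ) + #(C.nonMemberSubfamily v) = #C := by
          exact_mod_cast hsplit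
        linarith
      have h0 : 0 ≤ Ring.choose (x - 1) (r + 1 + 1) :=
        Ring.real_choose_nonneg (by push_cast; linarith)
      have h2 : (C.nonMemberSubfamily v).Nonempty := by
        rw [← card_pos]; exact_mod_cast h0.trans_lt h1
      have h3 := ihg _ (by have := card_pos.2 hmempos; omega) hnon h2
        (by push_cast; linarith) h1.le rfl
      have h4 : (#(∂ (C.nonMemberSubfamily v)) : ℝ) ≤ #(C.memberSubfamily v) := by
        exact_mod_cast card_le_card hshift
      linarith
    have h5 := ihr (sized_memberSubfamily hC.1) hmempos (by linarith) hmem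
    rw [hpascal']
    have h6 : (#(C.memberSubfamily v) : ℝ) + #(∂ (C.memberSubfamily v)) ≤ #(∂ C) := by
      exact_mod_cast (by omega :
        #(C.memberSubfamily v) + #(∂ (C.memberSubfamily v)) ≤ #(∂ C))
    linarith

/-- With |G| = C(x₁,r+1) and x₁ ≤ x, the ratio C(x₁,r)/C(x₁,r+1) = (r+1)/(x₁-r) decreases in x₁. -/
lemma real_card_mul_le_card_shadow_mul {r : ℕ} {G : Finset (Finset (Fin N))} {x : ℝ}
    (hG : (G : Set (Finset (Fin N))).Sized (r + 1)) (hx : (r : ℝ) ≤ x)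
    (hcard : (#G : ℝ) ≤ Ring.choose x (r + 1)) :
    (#G : ℝ) * (r + 1) ≤ #(∂ G) * (x - r) := by
  rcases G.eq_empty_or_nonempty with rfl | hne
  · simp
  obtain ⟨x₁, hx₁, he⟩ := Ring.exists_real_choose_eq (v := #G)
    (by exact_mod_cast card_pos.2 hne) r
  push_cast at hx₁
  have h1 : x₁ ≤ x := by
    by_contra hlt
    push Not at hlt
    have := Ring.real_choose_strictMono hx hlt
    linarith
  have h2 := real_choose_le_card_shadow hG hne (by linarith) he.le
  rw [← he, Ring.real_choose_succ_mul]
  gcongr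
  linarith

lemma exists_isInitSeg_powersetCard (r : ℕ) {w : ℕ} (hw : w ≤ N) :
    ∃ X : Finset (Fin N), #X = w ∧ Colex.IsInitSeg (X.powersetCard r) r := by
  set X : Finset (Fin N) := attachFin (range w) fun m hm => (mem_range.1 hm).trans_le hw with hX
  refine ⟨X, by rw [hX, card_attachFin, card_range], Set.sized_powersetCard _ _, ?_⟩
  rintro A B hA ⟨HB₁, HB₂⟩
  rw [mem_powersetCard] at hA ⊢
  refine ⟨fun t ht ↦ ?_, ‹_›⟩
  rw [hX, mem_attachFin, mem_range]
  have : toColex (image Fin.val B) < toColex (image Fin.val A) := by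
    rwa [Colex.toColex_image_lt_toColex_image Fin.val_strictMono]
  apply Colex.forall_lt_mono this.le _ t (mem_image.2 ⟨t, ht, rfl⟩)
  simp_rw [mem_image]
  rintro _ ⟨a, ha, hab⟩
  simpa [hX, hab] using hA.1 ha

/-- A colex initial segment with at most C(w,r) members fits into the first `w` points. This brings
a family on a larger ground set into a set where complements can be taken. -/
lemma exists_subset_powersetCard_card_shadow_le {r w : ℕ} {G : Finset (Finset (Fin N))}
    (hG : (G : Set (Finset (Fin N))).Sized r) (hw : w ≤ N) (hcard : #G ≤ w.choose r) :
    ∃ (X : Finset (Fin N)) (C : Finset (Finset (Fin N))), #X = w ∧ C ⊆ X.powersetCard r ∧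
      #C = #G ∧ #(∂ C) ≤ #(∂ G) := by
  obtain ⟨C, hC, hCg⟩ := exists_isInitSeg_card (N := N)
    (hcard.trans (Nat.choose_le_choose r hw))
  obtain ⟨X, hXw, hXseg⟩ := exists_isInitSeg_powersetCard r hw
  refine ⟨X, C, hXw, ?_, hCg, kruskal_katona hG hCg.le hC⟩
  rcases hC.total hXseg with h | h
  · exact h
  · refine (eq_of_subset_of_card_le h ?_).ge
    rw [card_powersetCard, hXw, hCg]
    exact hcard

/-- Any superset in `X` of a set missing from `∂ A` is missing from `A`. Under complementation in
`X`, this says that the shadow of the complements of `M` consists of complements of non-members of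
`A`. -/
lemma exists_compl_family {r s : ℕ} {X : Finset (Fin N)} {A M : Finset (Finset (Fin N))}
    (hA : A ⊆ X.powersetCard (r + 1)) (hX : #X = r + s) (hM : M ⊆ X.powersetCard r \ ∂ A) :
    ∃ T : Finset (Finset (Fin N)), (T : Set (Finset (Fin N))).Sized s ∧ #T = #M ∧
      #(∂ T) + #A ≤ (r + s).choose (r + 1) := by
  have hMX : ∀ S ∈ M, S ⊆ X ∧ #S = r :=
    fun S hS => mem_powersetCard.1 (mem_sdiff.1 (hM hS)).1
  refine ⟨M.image (X \ ·), ?_, ?_, ?_⟩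
  · intro S hS
    obtain ⟨R, hR, rfl⟩ := mem_image.1 (mem_coe.1 hS)
    rw [card_sdiff_of_subset (hMX R hR).1, hX, (hMX R hR).2]
    omega
  · refine card_image_of_injOn fun S hS S' hS' h => ?_
    rw [← sdiff_sdiff_eq_self (hMX S hS).1, ← sdiff_sdiff_eq_self (hMX S' hS').1,
      show X \ S = X \ S' from h]
  have hsh : #(∂ (M.image (X \ ·))) ≤ #(X.powersetCard (r + 1) \ A) := by
    refine card_le_card_of_injOn (X \ ·) ?_ ?_
    · intro S hS
      obtain ⟨S', hS', a, ha, rfl⟩ := mem_shadow_iff.1 (mem_coe.1 hS)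
      obtain ⟨R, hR, rfl⟩ := mem_image.1 hS'
      rw [mem_sdiff] at ha
      have he : X \ ((X \ R).erase a) = insert a R := by
        ext z
        simp only [mem_sdiff, mem_erase, mem_insert]
        constructor
        · rintro ⟨h1, h2⟩
          by_cases hz : z = a
          · exact Or.inl hz
          · right; by_contra h3; exact h2 ⟨hz, h1, h3⟩
        · rintro (rfl | h)
          · exact ⟨ha.1, fun h => h.1 rfl⟩
          · exact ⟨(hMX R hR).1 h, fun h' => h'.2.2 h⟩
      simp only [he, coe_sdiff, Set.mem_sdiff, mem_coe, mem_powersetCard]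
      refine ⟨⟨insert_subset ha.1 (hMX R hR).1, ?_⟩, fun h => ?_⟩
      · rw [card_insert_of_notMem ha.2, (hMX R hR).2]
      · exact (mem_sdiff.1 (hM hR)).2 (mem_shadow_iff_insert_mem.2 ⟨a, ha.2, h⟩)
    · have hsub : ∀ S ∈ ∂ (M.image (X \ ·)), S ⊆ X := by
        intro S hS
        obtain ⟨S', hS', a, ha, rfl⟩ := mem_shadow_iff.1 hS
        obtain ⟨S, hS, rfl⟩ := mem_image.1 hS'
        exact (erase_subset _ _).trans sdiff_subset
      intro S hS S' hS' h
      rw [← sdiff_sdiff_eq_self (hsub S hS), ← sdiff_sdiff_eq_self (hsub S' hS'),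
        show X \ S = X \ S' from h]
  rw [card_sdiff_of_subset hA, card_powersetCard, hX] at hsh
  have h1 := card_le_card hA
  rw [card_powersetCard, hX] at h1
  omega

/-- A family missing at most `choose y i` of the subsets of `X` of a given size has a shadow
missing at most `choose y (i + 1)` of the subsets of `X` of size one less. -/
theorem choose_sub_real_choose_le_card_shadow {r i : ℕ} {X : Finset (Fin N)}
    {A : Finset (Finset (Fin N))} {y : ℝ} (hA : A ⊆ X.powersetCard (r + 1))
    (hX : #X = r + i + 2) (hy : (i : ℝ) + 1 ≤ y)
    (hcard : ((r + i + 2).choose (r + 1) : ℝ) - #A ≤ Ring.choose y (i + 1)) :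
    ((r + i + 2).choose r : ℝ) - Ring.choose y (i + 2) ≤ #(∂ A) := by
  -- If more than C(y,i+2) sets were missing from `∂ A`, Lovász's bound for their complements would
  -- make more than C(y,i+1) sets missing from `A`.
  obtain ⟨T, hTs, hTM, hsh⟩ := exists_compl_family (r := r) (s := i + 2) (A := A)
    (M := X.powersetCard r \ ∂ A) hA hX subset_rfl
  have hsh' : (#(∂ T) : ℝ) ≤ Ring.choose y (i + 1) := by
    have : (#(∂ T) : ℝ) + #A ≤ (r + i + 2).choose (r + 1) := by exact_mod_cast hsh
    linarith
  have hMle : (#T : ℝ) ≤ Ring.choose y (i + 2) := by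
    by_contra hlt
    push Not at hlt
    have h0 : 0 ≤ Ring.choose y (i + 2) := Ring.real_choose_nonneg (by push_cast; linarith)
    have hne : T.Nonempty := by rw [← card_pos]; exact_mod_cast h0.trans_lt hlt
    obtain ⟨y₁, hy₁, he⟩ := Ring.exists_real_choose_eq (v := #T)
      (by exact_mod_cast card_pos.2 hne) (i + 1)
    push_cast at hy₁
    have hyy : y < y₁ := by
      by_contra hle
      push Not at hle
      have : Ring.choose y₁ (i + 1 + 1) ≤ Ring.choose y (i + 1 + 1) :=
        Ring.real_choose_mono (by push_cast; linarith) hle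
      rw [he] at this
      exact absurd hlt (not_lt.2 this)
    have h1 := real_choose_le_card_shadow hTs hne (x := y₁) (by push_cast; linarith) he.le
    have h2 := Ring.real_choose_strictMono (j := i) (by linarith) hyy
    linarith
  have h1 := le_card_sdiff (∂ A) (X.powersetCard r)
  rw [card_powersetCard, hX, tsub_le_iff_right, ← hTM] at h1
  have h2 : ((r + i + 2).choose r : ℝ) ≤ #T + #(∂ A) := by exact_mod_cast h1
  linarith

end Finset

/-! ### Chord bounds for shadows and the construction of the profile. -/

namespace Finset

open scoped FinsetFamily

variable {N : ℕ}

/-- The Lovász curve z ↦ (C(z,r+1), C(z,r)) stays above a line of slope `θ` from its point at `u` as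
soon as it does so at `w`: the height above the line is C(z,r) times an affine function, which has
no interior dip. -/
lemma le_card_shadow_of_real_choose_le {r : ℕ} {G : Finset (Finset (Fin N))} {u w θ : ℝ}
    (hG : (G : Set (Finset (Fin N))).Sized (r + 1)) (hθ : 0 ≤ θ) (hu : (r : ℝ) + 1 ≤ u)
    (huw : u ≤ w) (h1 : Ring.choose u (r + 1) ≤ #G) (h2 : (#G : ℝ) ≤ Ring.choose w (r + 1))
    (h : Ring.choose u r - θ * Ring.choose u (r + 1) ≤
      Ring.choose w r - θ * Ring.choose w (r + 1)) :
    Ring.choose u r + θ * (#G - Ring.choose u (r + 1)) ≤ #(∂ G) := by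
  have hpos : (0 : ℝ) < #G :=
    (Ring.real_choose_pos (x := u) (j := r + 1) (by push_cast; linarith)).trans_le h1
  have hne : G.Nonempty := card_pos.1 (by exact_mod_cast hpos)
  obtain ⟨v, hv, he⟩ := Ring.exists_real_choose_eq (v := #G)
    (by exact_mod_cast card_pos.2 hne) r
  push_cast at hv
  have hr : (0 : ℝ) < r + 1 := by positivity
  have huv : u ≤ v := by
    by_contra hlt
    push Not at hlt
    have := Ring.real_choose_strictMono (j := r) (by linarith) hlt
    linarith
  have hvw : v ≤ w := by
    by_contra hlt
    push Not at hlt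
    have := Ring.real_choose_strictMono (j := r) (by linarith) hlt
    linarith
  have key : ∀ z : ℝ, Ring.choose z r - θ * Ring.choose z (r + 1) =
      Ring.choose z r * ((1 + θ * r / (r + 1)) - θ / (r + 1) * z) := by
    intro z
    have h3 : Ring.choose z (r + 1) = Ring.choose z r * (z - r) / (r + 1) := by
      rw [eq_div_iff hr.ne', Ring.real_choose_succ_mul]
    rw [h3]; field_simp; ring
  rw [key, key] at h
  have h3 := Ring.real_choose_mul_affine_le (by positivity) (by linarith) huv hvw h
  rw [← key, ← key] at h3
  have h4 := real_choose_le_card_shadow hG hne (by linarith) he.le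
  rw [← he]
  linarith

/-- The chord argument for the complementary curve, parametrised by the number of missing sets. -/
lemma le_card_shadow_of_missing_le {r i : ℕ} {X : Finset (Fin N)}
    {A : Finset (Finset (Fin N))} {u w θ : ℝ} (hA : A ⊆ X.powersetCard (r + 1))
    (hX : #X = r + i + 2) (hu : (i : ℝ) + 1 ≤ u) (huw : u ≤ w)
    (h1 : Ring.choose u (i + 1) ≤ ((r + i + 2).choose (r + 1) : ℝ) - #A)
    (h2 : ((r + i + 2).choose (r + 1) : ℝ) - #A ≤ Ring.choose w (i + 1))
    (h : θ * Ring.choose u (i + 1) - Ring.choose u (i + 2) ≤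
      θ * Ring.choose w (i + 1) - Ring.choose w (i + 2)) :
    ((r + i + 2).choose r : ℝ) - Ring.choose u (i + 2) -
      θ * (((r + i + 2).choose (r + 1) : ℝ) - #A - Ring.choose u (i + 1)) ≤ #(∂ A) := by
  have hpos := (Ring.real_choose_pos (x := u) (j := i + 1) (by push_cast; linarith)).trans_le h1
  obtain ⟨v, hv, he⟩ := Ring.exists_real_choose_eq
    (v := ((r + i + 2).choose (r + 1) : ℝ) - #A) (by
      have : (#A : ℝ) + 1 ≤ ((r + i + 2).choose (r + 1) : ℝ) := by
        exact_mod_cast sub_pos.1 hpos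
      linarith) i
  push_cast at hv
  have hr : (0 : ℝ) < i + 1 + 1 := by positivity
  have huv : u ≤ v := by
    by_contra hlt
    push Not at hlt
    have := Ring.real_choose_strictMono (j := i) (by linarith) hlt
    linarith
  have hvw : v ≤ w := by
    by_contra hlt
    push Not at hlt
    have := Ring.real_choose_strictMono (j := i) (by linarith) hlt
    linarith
  have key : ∀ z : ℝ, θ * Ring.choose z (i + 1) - Ring.choose z (i + 2) =
      Ring.choose z (i + 1) * ((θ + (i + 1) / (i + 1 + 1)) - 1 / (i + 1 + 1) * z) := by
    intro z
    have h3 : Ring.choose z (i + 2) = Ring.choose z (i + 1) * (z - (i + 1)) / (i + 1 + 1) := by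
      have := Ring.real_choose_succ_mul z (i + 1)
      push_cast at this
      rw [eq_div_iff hr.ne', ← this]
    rw [h3]; field_simp; ring
  rw [key, key] at h
  have h3 := Ring.real_choose_mul_affine_le (by positivity) (by push_cast; linarith) huv hvw h
  rw [← key, ← key] at h3
  have h4 := choose_sub_real_choose_le_card_shadow hA hX hv he.ge
  rw [← he]
  linarith

lemma le_card_shadow_of_large {l i : ℕ} (hN : l + i + 4 ≤ N) {z : ℝ}
    {G : Finset (Finset (Fin N))} (hG : (G : Set (Finset (Fin N))).Sized (l + 2))
    (hiz : (i : ℝ) + 2 ≤ z)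
    (hz : ((l + i + 4).choose (l + 2) : ℝ) - Ring.choose z (i + 2) ≤ #G) :
    ((l + i + 4).choose (l + 1) : ℝ) - Ring.choose z (i + 3) ≤ #(∂ G) := by
  -- Truncating `G` lets its initial segment fit into an (n-1)-set.
  obtain ⟨G', hG', hc'⟩ := exists_subset_card_eq (min_le_left #G ((l + i + 4).choose (l + 2)))
  obtain ⟨X, C, hX, hCX, hCG, hCs⟩ := exists_subset_powersetCard_card_shadow_le
    (w := l + i + 4) (hG.mono (by exact_mod_cast hG')) (by omega) (hc'.trans_le (min_le_right _ _))
  have h1 : #(∂ C) ≤ #(∂ G) := hCs.trans (card_le_card (shadow_mono hG'))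
  have hz0 : 0 ≤ Ring.choose z (i + 2) := Ring.real_choose_nonneg (by push_cast; linarith)
  have e : l + 1 + (i + 1) + 2 = l + i + 4 := by omega
  have h2 := choose_sub_real_choose_le_card_shadow (r := l + 1) (i := i + 1) (y := z) hCX
    (by rw [hX]; omega) (by push_cast; linarith) (by
      rw [e, hCG, hc', Nat.cast_min, sub_le_iff_le_add, ← sub_le_iff_le_add', le_min_iff]
      exact ⟨hz, by linarith⟩)
  rw [e] at h2
  have h3 : (#(∂ C) : ℝ) ≤ #(∂ G) := by exact_mod_cast h1
  exact h2.trans h3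

lemma le_card_shadow_of_middle {l i : ℕ} (hN : l + i + 4 ≤ N) {u w θ : ℝ}
    {G : Finset (Finset (Fin N))} (hG : (G : Set (Finset (Fin N))).Sized (l + 2))
    (hiu : (i : ℝ) + 2 ≤ u) (hu : u ≤ w)
    (h1 : ((l + i + 4).choose (l + 2) : ℝ) - Ring.choose w (i + 2) ≤ #G)
    (h2 : #G ≤ ((l + i + 4).choose (l + 2) : ℝ) - Ring.choose u (i + 2))
    (h3 : θ * Ring.choose u (i + 2) - Ring.choose u (i + 3) ≤
      θ * Ring.choose w (i + 2) - Ring.choose w (i + 3)) :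
    ((l + i + 4).choose (l + 1) : ℝ) - Ring.choose u (i + 3) -
      θ * ((l + i + 4).choose (l + 2) - #G - Ring.choose u (i + 2)) ≤ #(∂ G) := by
  have hu0 : 0 ≤ Ring.choose u (i + 2) := Ring.real_choose_nonneg (by push_cast; linarith)
  obtain ⟨X, C, hX, hCX, hCG, hCs⟩ := exists_subset_powersetCard_card_shadow_le
    (w := l + i + 4) hG (by omega) (by
      have : (#G : ℝ) ≤ (l + i + 4).choose (l + 2) := by linarith
      exact_mod_cast this)
  have e : l + 1 + (i + 1) + 2 = l + i + 4 := by omega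
  have h4 := le_card_shadow_of_missing_le (r := l + 1) (i := i + 1) (u := u)
    (w := w) (θ := θ) hCX (by rw [hX]; omega) (by push_cast; linarith) hu
    (by rw [e, hCG]; linarith) (by rw [e, hCG]; linarith) h3
  rw [e, hCG] at h4
  have h5 : (#(∂ C) : ℝ) ≤ #(∂ G) := by exact_mod_cast hCs
  exact h4.trans h5

/-- Numerical data comparing the shadow sizes of `(l + 2)`-uniform and `(l + 3)`-uniform families
with a concave piecewise linear profile through `(0, 0)`, `(q, L)` and `(p, D)`. -/
structure ShadowProfile (N l i : ℕ) where
  -- `μ` and `τ` are the slopes of the two rising pieces. `σ` is the slope of the line from (c, b)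
  -- to (b + c, a + b), the Lovász points at n - 3 and n - 2; both breakpoints lie on or below this
  -- line.
  (a b c σ q L p D τ μ : ℝ)
  ha : a = (l + i + 2).choose l
  hb : b = (l + i + 2).choose (l + 1)
  hc : c = (l + i + 2).choose (l + 2)
  hσ : σ * (i + 2) = l + 1
  hσb : σ * b = a
  hq : q ≤ c
  hqpos : 0 < q
  hLb : L ≤ b
  hp : c + 2 * b ≤ p
  hp' : p ≤ c + 2 * b + a
  hL : L ≤ b + σ * (q - c)
  hD : D ≤ b + σ * (p - c)
  hσμ : σ ≤ μ
  hτ : 0 ≤ τ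
  hτμ : τ ≤ μ
  hμ : μ * q = L
  hτD : L + τ * (p - q) = D
  le_shadow : ∀ G : Finset (Finset (Fin N)), (G : Set (Finset (Fin N))).Sized (l + 2) →
    min (μ * #G) (min (L + τ * (#G - q)) D) ≤ #(∂ G)
  le_shadow_of_le : ∀ G : Finset (Finset (Fin N)), (G : Set (Finset (Fin N))).Sized (l + 2) →
    q ≤ #G → #G ≤ c → L + σ * (#G - q) ≤ #(∂ G)
  le_shadow_of_ge : ∀ G : Finset (Finset (Fin N)), (G : Set (Finset (Fin N))).Sized (l + 2) →
    c ≤ #G → b + σ * (min (#G : ℝ) (c + 2 * b) - c) ≤ #(∂ G)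
  le_shadow_of_subset : ∀ (X : Finset (Fin N)) (A : Finset (Finset (Fin N))), #X = l + i + 5 →
    A ⊆ X.powersetCard (l + 3) → ((l + i + 4).choose (l + 3) : ℝ) + (c + b) ≤ #A →
    ((l + i + 4).choose (l + 2) : ℝ) +
      min (μ * (#A - (l + i + 4).choose (l + 3)))
        (min (L + τ * (#A - (l + i + 4).choose (l + 3) - q)) D) ≤ #(∂ A)

lemma choose_add_two (l i : ℕ) :
    ((l + i + 2).choose (l + 1)) * (l + 1) = (l + i + 2).choose l * (i + 2) := by
  have := Nat.choose_succ_right_eq (l + i + 2) l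
  rw [this]; congr 1; omega

set_option maxHeartbeats 1000000 in
-- The assumptions x ≤ n - 3 and y ≤ n - 3 put both breakpoints below the reference line of slope
-- `σ`. Hence the chord between them passes below the true curve at the junction n - 2, where the
-- direct and complementary ranges meet at size b + c.
lemma exists_shadowProfile {l i : ℕ} (hN : l + i + 5 ≤ N) {x y : ℝ}
    (hx₁ : (l : ℝ) + 2 ≤ x) (hx₂ : x ≤ l + i + 2) (hy₁ : (i : ℝ) + 2 ≤ y) (hy₂ : y ≤ l + i + 2) :
    ∃ S : ShadowProfile N l i, S.q = Ring.choose x (l + 2) ∧ S.L = Ring.choose x (l + 1) ∧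
      S.p = (l + i + 4).choose (l + 2) - Ring.choose y (i + 2) ∧
      S.D = (l + i + 4).choose (l + 1) - Ring.choose y (i + 3) := by
  obtain ⟨a, ha⟩ : ∃ v : ℝ, v = ((l + i + 2).choose l : ℝ) := ⟨_, rfl⟩
  obtain ⟨b, hb⟩ : ∃ v : ℝ, v = ((l + i + 2).choose (l + 1) : ℝ) := ⟨_, rfl⟩
  obtain ⟨c, hc⟩ : ∃ v : ℝ, v = ((l + i + 2).choose (l + 2) : ℝ) := ⟨_, rfl⟩
  obtain ⟨d, hd⟩ : ∃ v : ℝ, v = ((l + i + 2).choose (i + 3) : ℝ) := ⟨_, rfl⟩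
  obtain ⟨σ, hσd⟩ : ∃ v : ℝ, v = ((l : ℝ) + 1) / (i + 2) := ⟨_, rfl⟩
  obtain ⟨q, hq⟩ : ∃ v : ℝ, v = Ring.choose x (l + 2) := ⟨_, rfl⟩
  obtain ⟨L, hL⟩ : ∃ v : ℝ, v = Ring.choose x (l + 1) := ⟨_, rfl⟩
  obtain ⟨Y, hY⟩ : ∃ v : ℝ, v = Ring.choose y (i + 2) := ⟨_, rfl⟩
  obtain ⟨W, hW⟩ : ∃ v : ℝ, v = Ring.choose y (i + 3) := ⟨_, rfl⟩
  have hi2 : (0 : ℝ) < i + 2 := by positivity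
  have hl1 : (0 : ℝ) < l + 1 := by positivity
  have hσpos : 0 < σ := by rw [hσd]; positivity
  have hσ : σ * (i + 2) = l + 1 := by rw [hσd]; field_simp
  have hbpos : 0 < b := by rw [hb]; exact_mod_cast Nat.choose_pos (by omega)
  have hapos : 0 < a := by rw [ha]; exact_mod_cast Nat.choose_pos (by omega)
  have hcpos : 0 < c := by rw [hc]; exact_mod_cast Nat.choose_pos (by omega)
  have hσb : σ * b = a := by
    have : b * (l + 1) = a * (i + 2) := by
      rw [ha, hb]; exact_mod_cast choose_add_two l i
    rw [hσd]; field_simp; linarith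
  have hcb : c * (l + 2) = b * (i + 1) := by
    rw [hb, hc]
    have := Nat.choose_succ_right_eq (l + i + 2) (l + 1)
    rw [show l + i + 2 - (l + 1) = i + 1 by omega] at this
    exact_mod_cast this
  -- binomial coefficients of `n - 3`, `n - 2`, `n - 1` in terms of `a, b, c, d`
  have e1 : Ring.choose ((l : ℝ) + i + 2) (l + 2) = c := by
    rw [hc, ← Ring.choose_natCast]; push_cast; rfl
  have e2 : Ring.choose ((l : ℝ) + i + 2) (l + 1) = b := by
    rw [hb, ← Ring.choose_natCast]; push_cast; rfl
  have e3 : Ring.choose ((l : ℝ) + i + 2) (i + 2) = a := by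
    rw [ha, ← Nat.choose_symm_of_eq_add (show l + i + 2 = (i + 2) + l by omega),
      ← Ring.choose_natCast]; push_cast; rfl
  have e4 : Ring.choose ((l : ℝ) + i + 2) (i + 3) = d := by
    rw [hd, ← Ring.choose_natCast]; push_cast; rfl
  have e2' : Ring.choose ((l : ℝ) + i + 2) (i + 1) = b := by
    rw [hb, ← Nat.choose_symm_of_eq_add (show l + i + 2 = (i + 1) + (l + 1) by omega),
      ← Ring.choose_natCast]; push_cast; rfl
  have P : ∀ j, Ring.choose ((l : ℝ) + i + 3) (j + 1) =
      Ring.choose ((l : ℝ) + i + 2) j + Ring.choose ((l : ℝ) + i + 2) (j + 1) := by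
    intro j
    rw [← Ring.choose_succ_succ]; ring_nf
  have f1 : Ring.choose ((l : ℝ) + i + 3) (l + 2) = b + c := by rw [P, e2, e1]
  have f2 : Ring.choose ((l : ℝ) + i + 3) (l + 1) = a + b := by
    rw [P, e2, ha, ← Ring.choose_natCast]; push_cast; rfl
  have f3 : Ring.choose ((l : ℝ) + i + 3) (i + 2) = b + a := by rw [P, e2', e3]
  have f4 : Ring.choose ((l : ℝ) + i + 3) (i + 3) = a + d := by rw [P, e3, e4]
  have g1 : ((l + i + 4).choose (l + 2) : ℝ) = c + 2 * b + a := by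
    rw [ha, hb, hc]
    have : (l + i + 4).choose (l + 2) = (l + i + 2).choose (l + 2) +
        2 * (l + i + 2).choose (l + 1) + (l + i + 2).choose l := by
      rw [Nat.choose_succ_succ (l + i + 3), Nat.choose_succ_succ (l + i + 2),
        Nat.choose_succ_succ (l + i + 2)]
      simp only [Nat.succ_eq_add_one]
      ring
    exact_mod_cast this
  have g2 : ((l + i + 4).choose (l + 1) : ℝ) = b + 2 * a + d := by
    rw [← Nat.choose_symm_of_eq_add (show l + i + 4 = (i + 3) + (l + 1) by omega),
      Nat.choose_succ_succ (l + i + 3)]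
    have h3 := f3
    have h4 := f4
    rw [show ((l : ℝ) + i + 3) = ((l + i + 3 : ℕ) : ℝ) by push_cast; ring,
      Ring.choose_natCast] at h3 h4
    simp only [Nat.succ_eq_add_one]
    push_cast
    rw [h3, h4]; ring
  have hqc : q ≤ c := by
    rw [hq, ← e1]; exact Ring.real_choose_mono (by push_cast; linarith) hx₂
  have hqpos : 0 < q := hq ▸ Ring.real_choose_pos (by push_cast; linarith)
  have hLb : L ≤ b := by
    rw [hL, ← e2]; exact Ring.real_choose_mono (by push_cast; linarith) hx₂
  have hYa : Y ≤ a := by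
    rw [hY, ← e3]; exact Ring.real_choose_mono (by push_cast; linarith) hy₂
  have hY0 : 0 ≤ Y := hY ▸ Ring.real_choose_nonneg (by push_cast; linarith)
  have hWd : W ≤ d := by
    rw [hW, ← e4]; exact Ring.real_choose_mono (by push_cast; linarith) hy₂
  obtain ⟨p, hp⟩ : ∃ v : ℝ, v = ((l + i + 4).choose (l + 2) : ℝ) - Y := ⟨_, rfl⟩
  obtain ⟨D, hD⟩ : ∃ v : ℝ, v = ((l + i + 4).choose (l + 1) : ℝ) - W := ⟨_, rfl⟩
  have hpge : c + 2 * b ≤ p := by rw [hp, g1]; linarith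
  have hDge : b + 2 * a ≤ D := by rw [hD, g2]; linarith
  have hpq : 0 < p - q := by linarith
  obtain ⟨τ, hτd⟩ : ∃ v : ℝ, v = (D - L) / (p - q) := ⟨_, rfl⟩
  have hτ : 0 ≤ τ := hτd ▸ div_nonneg (by linarith) hpq.le
  have hτD : L + τ * (p - q) = D := by rw [hτd]; field_simp; ring
  obtain ⟨μ, hμd⟩ : ∃ v : ℝ, v = ((l : ℝ) + 2) / (x - (l + 1)) := ⟨_, rfl⟩
  have hx1 : 0 < x - (l + 1) := by linarith
  have hμ : μ * q = L := by
    have := Ring.real_choose_succ_mul x (l + 1)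
    push_cast at this
    rw [hμd, div_mul_eq_mul_div, div_eq_iff hx1.ne', hq, hL, ← this]; ring
  have hσμ : σ ≤ μ := by
    rw [hσd, hμd, div_le_div_iff₀ hi2 hx1]
    exact mul_le_mul (by linarith) (by linarith) hx1.le (by positivity)
  have hbμ : b ≤ μ * c := by
    rw [hμd, div_mul_eq_mul_div, le_div_iff₀ hx1, mul_comm _ c, hcb]
    exact mul_le_mul_of_nonneg_left (by linarith) hbpos.le
  -- Since σb = a, the function C(z,l+1) - σC(z,l+2) agrees at n - 3 and n - 2, so it cannot have
  -- decreased from `x` to n - 3.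
  have hgσ : L - σ * q ≤ b - σ * c := by
    have key : ∀ z : ℝ, Ring.choose z (l + 1) - σ * Ring.choose z (l + 2) =
        Ring.choose z (l + 1) * ((1 + σ * (l + 1) / (l + 2)) - σ / (l + 2) * z) := by
      intro z
      have h2 : (0 : ℝ) < l + 2 := by positivity
      have h3 : Ring.choose z (l + 2) = Ring.choose z (l + 1) * (z - (l + 1)) / (l + 2) := by
        have := Ring.real_choose_succ_mul z (l + 1)
        push_cast at this
        rw [eq_div_iff h2.ne', ← this]; ring
      rw [h3]; field_simp; ring
    have := Ring.real_choose_mul_affine_le_of_le (u := x) (v := (l : ℝ) + i + 2)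
      (w := (l : ℝ) + i + 3) (A := 1 + σ * (l + 1) / (l + 2)) (B := σ / (l + 2)) (j := l + 1)
      (by positivity) (by push_cast; linarith) hx₂ (by linarith) (by
        have : 1 + σ * (l + 1) / (l + 2) - σ / (l + 2) * ((l : ℝ) + i + 3) = 1 / (l + 2) := by
          field_simp
          linarith
        rw [this]; positivity) (by
        rw [← key, ← key, e1, e2, f1, f2]; linarith)
    rwa [← key, ← key, e1, e2, ← hL, ← hq] at this
  -- Again the values at n - 3 and n - 2 agree because σb = a.
  have hhσ : σ * Y - W ≤ σ * a - d := by
    have key : ∀ z : ℝ, σ * Ring.choose z (i + 2) - Ring.choose z (i + 3) =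
        Ring.choose z (i + 2) * ((σ + (i + 2) / (i + 3)) - 1 / (i + 3) * z) := by
      intro z
      have h2 : (0 : ℝ) < i + 3 := by positivity
      have h3 : Ring.choose z (i + 3) = Ring.choose z (i + 2) * (z - (i + 2)) / (i + 3) := by
        have := Ring.real_choose_succ_mul z (i + 2)
        push_cast at this
        rw [eq_div_iff h2.ne', ← this]; ring
      rw [h3]; field_simp; ring
    have := Ring.real_choose_mul_affine_le_of_le (u := y) (v := (l : ℝ) + i + 2)
      (w := (l : ℝ) + i + 3) (A := σ + (i + 2) / (i + 3)) (B := 1 / (i + 3)) (j := i + 2)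
      (by positivity) (by push_cast; linarith) hy₂ (by linarith) (by
        have : σ + ((i : ℝ) + 2) / (i + 3) - 1 / (i + 3) * ((l : ℝ) + i + 3) = σ / (i + 3) := by
          field_simp
          linarith
        rw [this]; positivity) (by
        rw [← key, ← key, e3, e4, f3, f4]; linarith)
    rwa [← key, ← key, e3, e4, ← hY, ← hW] at this
  have hLl : L ≤ b + σ * (q - c) := by linarith
  have hDl : D ≤ b + σ * (p - c) := by rw [hD, hp, g1, g2]; linarith
  have hτμ : τ ≤ μ := by
    rw [hτd, div_le_iff₀ hpq]
    have : σ * (p - c) ≤ μ * (p - c) := mul_le_mul_of_nonneg_right hσμ (by linarith)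
    linarith
  -- Interpolation between the two breakpoints: at b + c the reference line has height b + σb = a +
  -- b.
  have hmid : L + τ * (b + c - q) ≤ a + b := by
    have h1 : 0 ≤ (p - (b + c)) * (b + σ * (q - c) - L) := mul_nonneg (by linarith) (by linarith)
    have h2 : 0 ≤ (b + c - q) * (b + σ * (p - c) - D) := mul_nonneg (by linarith) (by linarith)
    rw [← hτD] at h2
    have h3 : 0 ≤ (p - q) * (a + b - (L + τ * (b + c - q))) := by
      rw [← hσb]
      refine le_of_le_of_eq (add_nonneg h1 h2) ?_
      ring
    have := nonneg_of_mul_nonneg_right h3 hpq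
    linarith
  have hhτ : τ * Y - W ≤ τ * (b + a) - (a + d) := by
    have : D - τ * p = L - τ * q := by linarith
    rw [hD, hp, g1, g2] at this
    linarith
  have hxN : x ≤ (l : ℝ) + i + 3 := by linarith
  have hyN : y ≤ (l : ℝ) + i + 3 := by linarith
  have hN4 : l + i + 4 ≤ N := by omega
  refine ⟨⟨a, b, c, σ, q, L, p, D, τ, μ, ha, hb, hc, hσ, hσb, hqc, hqpos, hLb, hpge,
    by rw [hp, g1]; linarith, hLl, hDl, hσμ, hτ, hτμ, hμ, hτD, ?_, ?_, ?_, ?_⟩, hq, hL, hp.trans (by rw [← hY]), hD.trans (by rw [← hW])⟩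
  · intro G hG
    -- The ranges up to q, b + c, p and beyond use, in turn, the shadow ratio, the direct chord, the
    -- complementary chord and the bound `D`.
    rcases le_or_gt (#G : ℝ) q with h1 | h1
    · refine (min_le_left _ _).trans ?_
      have := real_card_mul_le_card_shadow_mul (r := l + 1) (x := x) hG
        (by push_cast; linarith) (by rw [← hq]; exact h1)
      push_cast at this
      rw [hμd, div_mul_eq_mul_div, div_le_iff₀ hx1]
      linarith
    refine (min_le_right _ _).trans ?_
    rcases le_or_gt (#G : ℝ) (b + c) with h2 | h2
    · refine (min_le_left _ _).trans ?_
      have := le_card_shadow_of_real_choose_le (r := l + 1) hG hτ (by push_cast; linarith) hxN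
        (by rw [← hq]; exact h1.le) (by rw [f1]; exact h2) (by rw [f1, f2, ← hL, ← hq]; linarith)
      rwa [← hL, ← hq] at this
    rcases le_or_gt (#G : ℝ) p with h3 | h3
    · refine (min_le_left _ _).trans ?_
      have := le_card_shadow_of_middle hN4 (u := y) (w := (l : ℝ) + i + 3) (θ := τ) hG hy₁ hyN
        (by rw [g1, f3]; linarith) (by rw [← hY, ← hp]; exact h3)
        (by rw [f3, f4, ← hY, ← hW]; exact hhτ)
      rw [← hY, ← hW, g1, g2] at this
      refine le_trans (le_of_eq ?_) this
      have h4 : L = D - τ * (p - q) := by linarith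
      rw [h4, hD, hp, g1, g2]; ring
    · refine (min_le_right _ _).trans ?_
      rw [hD, hW]
      refine le_card_shadow_of_large hN4 hG hy₁ ?_
      rw [← hY, ← hp]; exact h3.le
  · intro G hG h1 h2
    have := le_card_shadow_of_real_choose_le (r := l + 1) hG hσpos.le (by push_cast; linarith)
      hx₂ (by rw [← hq]; exact h1) (by rw [e1]; exact h2) (by rw [e1, e2, ← hL, ← hq]; exact hgσ)
    rwa [← hL, ← hq] at this
  · intro G hG h1
    rcases le_or_gt (#G : ℝ) (b + c) with h2 | h2
    · rw [min_eq_left (by linarith)]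
      have := le_card_shadow_of_real_choose_le (r := l + 1) (u := (l : ℝ) + i + 2) (θ := σ)
        (w := (l : ℝ) + i + 3) hG hσpos.le (by push_cast; linarith)
        (by linarith) (by rw [e1]; exact h1) (by rw [f1]; exact h2)
        (by rw [e1, e2, f1, f2]; linarith)
      rwa [e1, e2] at this
    · rcases le_or_gt (#G : ℝ) (c + 2 * b) with h3 | h3
      · rw [min_eq_left h3]
        have := le_card_shadow_of_middle hN4 (u := (l : ℝ) + i + 2) (w := (l : ℝ) + i + 3) (θ := σ)
          hG (by linarith) (by linarith) (by rw [g1, f3]; linarith) (by rw [g1, e3]; linarith)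
          (by rw [e3, e4, f3, f4]; linarith)
        rw [e3, e4, g1, g2] at this
        linarith
      · rw [min_eq_right h3.le]
        have := le_card_shadow_of_large hN4 (z := (l : ℝ) + i + 2) hG (by linarith)
          (by rw [e3, g1]; linarith)
        rw [e4, g2] at this
        linarith
  · intro X A hX hA hcard
    have hN1 : ((l + i + 5).choose (l + 3) : ℝ) =
        (l + i + 4).choose (l + 3) + (c + 2 * b + a) := by
      rw [← g1, Nat.choose_succ_succ (l + i + 4)]; push_cast; ring
    have hN2 : ((l + i + 5).choose (l + 2) : ℝ) =
        (l + i + 4).choose (l + 2) + (b + 2 * a + d) := by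
      rw [← g2, Nat.choose_succ_succ (l + i + 4)]; push_cast; ring
    rcases le_or_gt (#A - (l + i + 4).choose (l + 3) : ℝ) p with h3 | h3
    · refine le_trans (add_le_add_right ((min_le_right _ _).trans (min_le_left _ _)) _) ?_
      have := le_card_shadow_of_missing_le (r := l + 2) (i := i + 1) (u := y)
        (w := (l : ℝ) + i + 3) (θ := τ) hA
        (by rw [hX]; omega) (by push_cast; linarith) hyN (by
          rw [show l + 2 + (i + 1) + 2 = l + i + 5 by omega, show l + 2 + 1 = l + 3 by omega,
            hN1]
          rw [hp, g1] at h3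
          rw [← hY]
          linarith) (by
          rw [show l + 2 + (i + 1) + 2 = l + i + 5 by omega, show l + 2 + 1 = l + 3 by omega,
            hN1, f3]; linarith) (by rw [f3, f4, ← hY, ← hW]; exact hhτ)
      rw [show l + 2 + (i + 1) + 2 = l + i + 5 by omega, show l + 2 + 1 = l + 3 by omega,
        hN1, hN2, ← hY, ← hW] at this
      refine le_trans (le_of_eq ?_) this
      have h4 : L = D - τ * (p - q) := by linarith
      rw [h4, hD, hp, g1, g2]; ring
    · refine le_trans (add_le_add_right ((min_le_right _ _).trans (min_le_right _ _)) _) ?_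
      have := choose_sub_real_choose_le_card_shadow (r := l + 2) (i := i + 1) (y := y) hA
        (by rw [hX]; omega) (by push_cast; linarith) (by
          rw [show l + 2 + (i + 1) + 2 = l + i + 5 by omega, show l + 2 + 1 = l + 3 by omega,
            hN1]
          rw [hp, g1] at h3
          rw [← hY]
          linarith)
      rw [show l + 2 + (i + 1) + 2 = l + i + 5 by omega, hN2, ← hW] at this
      refine le_trans (le_of_eq ?_) this
      rw [hD, g2]; ring

end Finset

/-! ### Concavity of the profile, and families concentrated on one n-set. -/

namespace Finset

open scoped FinsetFamily

variable {N l i : ℕ}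

namespace ShadowProfile

variable (S : ShadowProfile N l i)

/-- The concave piecewise linear profile attached to a `ShadowProfile`. -/
noncomputable def H (z : ℝ) : ℝ := min (S.μ * z) (min (S.L + S.τ * (z - S.q)) S.D)

lemma ha_pos : 0 < S.a := by rw [S.ha]; exact_mod_cast Nat.choose_pos (by omega)

lemma hb_pos : 0 < S.b := by rw [S.hb]; exact_mod_cast Nat.choose_pos (by omega)

lemma hσ_pos : 0 < S.σ := by
  have h1 := S.hσb
  have h2 := S.ha_pos
  have h3 := S.hb_pos
  by_contra h
  have : S.σ * S.b ≤ 0 := mul_nonpos_of_nonpos_of_nonneg (by linarith) h3.le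
  linarith

lemma hμ_nonneg : 0 ≤ S.μ := S.hτ.trans S.hτμ

lemma hq_lt_p : S.q < S.p := by
  have := S.hq; have := S.hp; have := S.hb_pos; linarith

lemma hL_le_D : S.L ≤ S.D := by
  have := S.hτD
  have : 0 ≤ S.τ * (S.p - S.q) := mul_nonneg S.hτ (by have := S.hq_lt_p; linarith)
  linarith

lemma hτq : S.τ * S.q ≤ S.L := by
  rw [← S.hμ]; exact mul_le_mul_of_nonneg_right S.hτμ S.hqpos.le

lemma hL_nonneg : 0 ≤ S.L := by
  rw [← S.hμ]; exact mul_nonneg S.hμ_nonneg S.hqpos.le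

lemma H_mono {u v : ℝ} (h : u ≤ v) : S.H u ≤ S.H v := by
  have h1 := mul_le_mul_of_nonneg_left h S.hμ_nonneg
  have h2 := mul_le_mul_of_nonneg_left h S.hτ
  exact min_le_min h1 (min_le_min (by linarith) le_rfl)

lemma H_nonneg {u : ℝ} (h : 0 ≤ u) : 0 ≤ S.H u := by
  refine le_min (mul_nonneg S.hμ_nonneg h) (le_min ?_ (S.hL_nonneg.trans S.hL_le_D))
  have := mul_nonneg S.hτ h
  have := S.hτq
  linarith

lemma H_add_le {u w : ℝ} (hw : 0 ≤ w) : S.H (u + w) ≤ S.H u + S.μ * w := by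
  have h1 : S.τ * w ≤ S.μ * w := mul_le_mul_of_nonneg_right S.hτμ hw
  have h2 : 0 ≤ S.μ * w := mul_nonneg S.hμ_nonneg hw
  rw [H, H, ← min_add_add_right, ← min_add_add_right]
  exact min_le_min (by linarith) (min_le_min (by linarith) (by linarith))

/-- Subadditivity of a concave function vanishing at 0. -/
lemma H_add_le_add {u v : ℝ} (hu : 0 ≤ u) (hv : 0 ≤ v) : S.H (u + v) ≤ S.H u + S.H v := by
  have h1 := S.H_add_le (u := u) hv
  have h2 := S.H_add_le (u := v) hu
  rw [add_comm v u] at h2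
  have h3 : S.H (u + v) ≤ S.D := (min_le_right _ _).trans (min_le_right _ _)
  have h4 : S.H (u + v) ≤ S.L + S.τ * (u + v - S.q) := (min_le_right _ _).trans (min_le_left _ _)
  have h5 := S.H_nonneg hu
  have h6 := S.H_nonneg hv
  have h7 := S.hτq
  rcases min_choice (S.μ * u) (min (S.L + S.τ * (u - S.q)) S.D) with hu' | hu'
  · have : S.H u = S.μ * u := hu'
    linarith
  rcases min_choice (S.μ * v) (min (S.L + S.τ * (v - S.q)) S.D) with hv' | hv'
  · have : S.H v = S.μ * v := hv'
    linarith
  rcases min_choice (S.L + S.τ * (u - S.q)) S.D with hu2 | hu2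
  · rcases min_choice (S.L + S.τ * (v - S.q)) S.D with hv2 | hv2
    · have e1 : S.H u = S.L + S.τ * (u - S.q) := hu'.trans hu2
      have e2 : S.H v = S.L + S.τ * (v - S.q) := hv'.trans hv2
      linarith
    · have : S.H v = S.D := hv'.trans hv2
      linarith
  · have : S.H u = S.D := hu'.trans hu2
    linarith

lemma le_H_of_mem {z : ℝ} (h1 : S.q ≤ z) (h2 : z ≤ S.p) : S.L + S.τ * (z - S.q) ≤ S.H z := by
  have h3 : S.τ * (z - S.q) ≤ S.μ * (z - S.q) :=
    mul_le_mul_of_nonneg_right S.hτμ (by linarith)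
  have h4 : S.τ * (z - S.q) ≤ S.τ * (S.p - S.q) := mul_le_mul_of_nonneg_left (by linarith) S.hτ
  have := S.hμ
  have := S.hτD
  exact le_min (by linarith) (le_min le_rfl (by linarith))

lemma le_H_of_le {z : ℝ} (h1 : z ≤ S.q) : S.μ * z ≤ S.H z := by
  have h3 : S.τ * (S.q - z) ≤ S.μ * (S.q - z) :=
    mul_le_mul_of_nonneg_right S.hτμ (by linarith)
  have h4 : S.μ * z ≤ S.μ * S.q := mul_le_mul_of_nonneg_left h1 S.hμ_nonneg
  have := S.hμ
  have := S.hL_le_D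
  exact le_min le_rfl (le_min (by linarith) (by linarith))

lemma L_le_H {z : ℝ} (h : S.q ≤ z) : S.L ≤ S.H z := by
  refine le_trans ?_ (S.H_mono h)
  have := S.le_H_of_mem le_rfl S.hq_lt_p.le
  simpa using this

lemma D_le_H {z : ℝ} (h : S.p ≤ z) : S.D ≤ S.H z := by
  refine le_trans ?_ (S.H_mono h)
  have := S.le_H_of_mem S.hq_lt_p.le le_rfl
  rwa [S.hτD] at this

lemma H_le_line {z : ℝ} (h : z ≤ S.p) : S.H z ≤ S.b + S.σ * (z - S.c) := by
  rcases le_total z S.q with hz | hz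
  · have h1 : S.H z ≤ S.μ * z := min_le_left _ _
    have h2 : S.σ * (S.q - z) ≤ S.μ * (S.q - z) :=
      mul_le_mul_of_nonneg_right S.hσμ (by linarith)
    have := S.hμ
    have := S.hL
    linarith
  · have h1 : S.H z ≤ S.L + S.τ * (z - S.q) := (min_le_right _ _).trans (min_le_left _ _)
    refine h1.trans ?_
    have hpq : 0 < S.p - S.q := by have := S.hq_lt_p; linarith
    have h2 : 0 ≤ (S.p - z) * (S.b + S.σ * (S.q - S.c) - S.L) :=
      mul_nonneg (by linarith) (by linarith [S.hL])
    have h3 : 0 ≤ (z - S.q) * (S.b + S.σ * (S.p - S.c) - (S.L + S.τ * (S.p - S.q))) :=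
      mul_nonneg (by linarith) (by have := S.hD; have := S.hτD; linarith)
    have h4 : 0 ≤ (S.p - S.q) * (S.b + S.σ * (z - S.c) - (S.L + S.τ * (z - S.q))) := by
      refine le_of_le_of_eq (add_nonneg h2 h3) ?_
      ring
    have := nonneg_of_mul_nonneg_right h4 hpq
    linarith

/-- Between q and p, `H` lies above its chord, so only the sum u + v matters. If p ≤ u, monotonicity
gives `D` and `L` separately. -/
lemma D_add_L_le {u v : ℝ} (hv : S.q ≤ v) (huv : S.p + S.q ≤ u + v) (h : v ≤ S.p ∨ S.p ≤ u) :
    S.D + S.L ≤ S.H u + S.H v := by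
  rcases le_or_gt S.p u with hu | hu
  · exact add_le_add (S.D_le_H hu) (S.L_le_H hv)
  · have hvp : v ≤ S.p := by
      rcases h with h | h
      · exact h
      · linarith
    have h1 := S.le_H_of_mem (z := u) (by linarith) hu.le
    have h2 := S.le_H_of_mem hv hvp
    have h3 : 0 ≤ S.τ * (u + v - (S.p + S.q)) := mul_nonneg S.hτ (by linarith)
    have := S.hτD
    linarith

/-- The `M` extra members of `G` enlarge the shadow at rate at least `σ`, which pays for `ρ`. Beyond
c + 2b the lower bound is frozen, and `ρ ≤ a` together with `P - M ≤ c + b` takes over. -/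
lemma H_add_le_card_shadow {P M ρ : ℝ} {G : Finset (Finset (Fin N))}
    (hG : (G : Set (Finset (Fin N))).Sized (l + 2)) (hP : P = #G) (hM : 0 ≤ M)
    (hρ : ρ ≤ S.σ * M) (hρ' : ρ ≤ S.a) (hPM : P - M ≤ S.c + S.b) :
    S.H (P - M) + ρ ≤ #(∂ G) := by
  have hK := S.le_shadow G hG
  have hK1 := S.le_shadow_of_le G hG
  have hK2 := S.le_shadow_of_ge G hG
  rw [← hP] at hK hK1 hK2
  change S.H P ≤ _ at hK
  have hσM : S.σ * M ≤ S.μ * M := mul_le_mul_of_nonneg_right S.hσμ hM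
  have hμ := S.hμ
  rcases le_or_gt P S.q with h1 | h1
  · have h2 := S.le_H_of_le h1
    have h3 : S.H (P - M) ≤ S.μ * (P - M) := min_le_left _ _
    linarith
  rcases le_or_gt P S.c with h2 | h2
  · have h3 := hK1 h1.le h2
    have h4 := S.le_H_of_mem h1.le (by have := S.hp; have := S.hb_pos; linarith)
    have h5 : S.H (P - M) ≤ S.μ * (P - M) := min_le_left _ _
    have h6 : S.H (P - M) ≤ S.L + S.τ * (P - M - S.q) :=
      (min_le_right _ _).trans (min_le_left _ _)
    rcases le_total S.σ S.τ with h7 | h7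
    · have := mul_le_mul_of_nonneg_right h7 hM
      linarith
    · rcases le_total S.q (P - M) with h8 | h8
      · have := mul_le_mul_of_nonneg_right h7 (sub_nonneg.2 h8)
        linarith
      · have := mul_le_mul_of_nonneg_right S.hσμ (sub_nonneg.2 h8)
        linarith
  · have h3 := hK2 h2.le
    have h4 : S.H (P - M) ≤ S.b + S.σ * (P - M - S.c) :=
      S.H_le_line (by have := S.hp; have := S.hb_pos; linarith)
    rcases le_total P (S.c + 2 * S.b) with h5 | h5
    · rw [min_eq_left h5] at h3
      linarith
    · rw [min_eq_right h5] at h3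
      have h6 : S.σ * (P - M) ≤ S.σ * (S.c + S.b) := mul_le_mul_of_nonneg_left hPM S.hσ_pos.le
      have := S.hσb
      linarith

lemma b_add_le_card_shadow {ρ t : ℝ} {G : Finset (Finset (Fin N))}
    (hG : (G : Set (Finset (Fin N))).Sized (l + 2)) (ht : 0 ≤ t) (hP : S.c + t ≤ #G)
    (hρ : ρ ≤ S.σ * t) (hρ' : ρ ≤ S.a) : S.b + ρ ≤ #(∂ G) := by
  have h := S.le_shadow_of_ge G hG (by linarith)
  have hσ := S.hσ_pos
  rcases le_total (#G : ℝ) (S.c + 2 * S.b) with h5 | h5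
  · rw [min_eq_left h5] at h
    have := mul_le_mul_of_nonneg_left (show t ≤ #G - S.c by linarith) hσ.le
    linarith
  · rw [min_eq_right h5] at h
    have := S.hσb
    have := S.ha_pos
    linarith

/-- Remove the points of `Y` one at a time: the link of a point has shadow at least `H`, the shadow
sets obtained from different points are distinct, and subadditivity adds up the contributions. -/
lemma H_le_card_filter_shadow (Y : Finset (Fin N)) (B : Finset (Finset (Fin N)))
    (hB : (B : Set (Finset (Fin N))).Sized (l + 3)) (hBY : ∀ T ∈ B, ¬ Disjoint T Y) :
    S.H #B ≤ #({T ∈ ∂ B | ¬ Disjoint T Y}) := by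
  induction Y using Finset.induction_on generalizing B with
  | empty =>
    have : B = ∅ := eq_empty_of_forall_notMem fun T hT => hBY T hT (disjoint_empty_right T)
    rw [this]
    refine (min_le_left _ _).trans ?_
    simp
  | insert w Y hw ih =>
    set 𝒮 := {T ∈ ∂ B | ¬ Disjoint T (insert w Y)} with h𝒮
    have h1 := card_memberSubfamily_add_card_nonMemberSubfamily w B
    have h2 := card_memberSubfamily_add_card_nonMemberSubfamily w 𝒮
    have h3 : ∂ (B.memberSubfamily w) ⊆ 𝒮.memberSubfamily w := by
      intro T hT
      have := shadow_memberSubfamily_subset w B hT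
      rw [mem_memberSubfamily] at this ⊢
      refine ⟨mem_filter.2 ⟨this.1, fun hd => ?_⟩, this.2⟩
      exact disjoint_left.1 hd (mem_insert_self w T) (mem_insert_self w Y)
    have h4 : {T ∈ ∂ (B.nonMemberSubfamily w) | ¬ Disjoint T Y} ⊆ 𝒮.nonMemberSubfamily w := by
      intro T hT
      rw [mem_filter] at hT
      rw [mem_nonMemberSubfamily, h𝒮, mem_filter]
      obtain ⟨R, hR, hTR⟩ := exists_subset_of_mem_shadow hT.1
      rw [mem_nonMemberSubfamily] at hR
      refine ⟨⟨shadow_monotone (fun R hR => (mem_nonMemberSubfamily.1 hR).1) hT.1, ?_⟩,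
        fun h => hR.2 (hTR h)⟩
      exact fun hd => hT.2 (hd.mono_right (subset_insert w Y))
    have h5 := S.le_shadow _ (sized_memberSubfamily (v := w) hB)
    have h6 := ih (B.nonMemberSubfamily w) (fun T hT => hB (mem_nonMemberSubfamily.1 hT).1) (by
      intro T hT hd
      rw [mem_nonMemberSubfamily] at hT
      exact hBY T hT.1 (disjoint_insert_right.2 ⟨hT.2, hd⟩))
    have h7 := S.H_add_le_add (u := #(B.memberSubfamily w)) (v := #(B.nonMemberSubfamily w))
      (by positivity) (by positivity)
    have h8 : (#(∂ (B.memberSubfamily w)) : ℝ) ≤ #(𝒮.memberSubfamily w) := by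
      exact_mod_cast card_le_card h3
    have h9 : (#({T ∈ ∂ (B.nonMemberSubfamily w) | ¬ Disjoint T Y}) : ℝ) ≤
        #(𝒮.nonMemberSubfamily w) := by exact_mod_cast card_le_card h4
    rw [← h1, ← h2]
    push_cast
    change S.H _ ≤ _ at h5
    linarith

end ShadowProfile

lemma card_shadow_inside_add_outside (F : Finset (Finset (Fin N))) (X : Finset (Fin N)) :
    #({T ∈ ∂ F | T ⊆ X}) + #({T ∈ ∂ ({R ∈ F | ¬ R ⊆ X}) | ¬ Disjoint T Xᶜ}) ≤ #(∂ F) := by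
  rw [← card_filter_add_card_filter_not (s := ∂ F) (· ⊆ X)]
  refine Nat.add_le_add_left (card_le_card fun T hT => ?_) _
  rw [mem_filter] at hT ⊢
  refine ⟨shadow_mono (filter_subset _ _) hT.1, fun h => hT.2 ?_⟩
  exact disjoint_left.2 fun a ha ha' => (mem_compl.1 ha') (h ha)

lemma ShadowProfile.H_le_outside (S : ShadowProfile N l i) (F : Finset (Finset (Fin N)))
    (hF : (F : Set (Finset (Fin N))).Sized (l + 3)) (X : Finset (Fin N)) :
    S.H #({R ∈ F | ¬ R ⊆ X}) ≤ #({T ∈ ∂ ({R ∈ F | ¬ R ⊆ X}) | ¬ Disjoint T Xᶜ}) := by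
  refine S.H_le_card_filter_shadow Xᶜ _ (hF.mono (by exact_mod_cast filter_subset _ _)) ?_
  intro T hT hd
  refine (mem_filter.1 hT).2 fun a ha => ?_
  by_contra h
  exact disjoint_left.1 hd ha (mem_compl.2 h)

/-- The shadow bound for a family that contains almost all subsets of a set `X`. -/
theorem ShadowProfile.le_card_shadow_of_inside (S : ShadowProfile N l i)
    {F : Finset (Finset (Fin N))} (hF : (F : Set (Finset (Fin N))).Sized (l + 3))
    {X : Finset (Fin N)} (hX : #X = l + i + 5)
    (hcard : ((l + i + 4).choose (l + 3) : ℝ) + S.p + S.q ≤ #F)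
    (hin : ((l + i + 4).choose (l + 3) : ℝ) + (S.c + S.b) ≤ #({R ∈ F | R ⊆ X}))
    (hout : S.q ≤ #({R ∈ F | ¬ R ⊆ X}))
    (hor : (#({R ∈ F | ¬ R ⊆ X}) : ℝ) ≤ S.p ∨
      ((l + i + 4).choose (l + 3) : ℝ) + S.p ≤ #({R ∈ F | R ⊆ X})) :
    ((l + i + 4).choose (l + 2) : ℝ) + S.D + S.L ≤ #(∂ F) := by
  have h1 := card_filter_add_card_filter_not (s := F) (· ⊆ X)
  have h2 := card_shadow_inside_add_outside F X
  have h3 := S.H_le_outside F hF X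
  have h4 := S.le_shadow_of_subset X {R ∈ F | R ⊆ X} hX (fun R hR => by
    rw [mem_filter] at hR
    exact mem_powersetCard.2 ⟨hR.2, hF hR.1⟩) hin
  have h5 : #(∂ {R ∈ F | R ⊆ X}) ≤ #({T ∈ ∂ F | T ⊆ X}) := by
    refine card_le_card fun T hT => mem_filter.2 ⟨shadow_mono (filter_subset _ _) hT, ?_⟩
    obtain ⟨R, hR, hTR⟩ := exists_subset_of_mem_shadow hT
    exact hTR.trans (mem_filter.1 hR).2
  have h1' : (#({R ∈ F | R ⊆ X}) : ℝ) + #({R ∈ F | ¬ R ⊆ X}) = #F := by exact_mod_cast h1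
  have h6 : (#(∂ {R ∈ F | R ⊆ X}) : ℝ) ≤ #({T ∈ ∂ F | T ⊆ X}) := by exact_mod_cast h5
  have h7 : (#({T ∈ ∂ F | T ⊆ X}) : ℝ) +
      #({T ∈ ∂ ({R ∈ F | ¬ R ⊆ X}) | ¬ Disjoint T Xᶜ}) ≤ #(∂ F) := by exact_mod_cast h2
  have h8 := S.D_add_L_le (u := #({R ∈ F | R ⊆ X}) - (l + i + 4).choose (l + 3)) hout
    (by linarith) (by
      rcases hor with h | h
      · exact Or.inl h
      · exact Or.inr (by linarith))
  have h9 : ((l + i + 4).choose (l + 2) : ℝ) +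
      S.H (#({R ∈ F | R ⊆ X}) - (l + i + 4).choose (l + 3)) ≤ #(∂ {R ∈ F | R ⊆ X}) := h4
  linarith

end Finset

/-! ### Links, and families concentrated on two n-sets. -/

namespace Finset

open scoped FinsetFamily

section Link

variable {α : Type*} [DecidableEq α]

/-- The `r`-subsets `T` of `Z` with `insert v T ∈ F`. -/
def linkIn (F : Finset (Finset α)) (Z : Finset α) (v : α) (r : ℕ) : Finset (Finset α) :=
  {T ∈ Z.powersetCard r | insert v T ∈ F}

lemma mem_linkIn {F : Finset (Finset α)} {Z : Finset α} {v : α} {r : ℕ} {T : Finset α} :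
    T ∈ linkIn F Z v r ↔ (T ⊆ Z ∧ #T = r) ∧ insert v T ∈ F := by
  rw [linkIn, mem_filter, mem_powersetCard]

lemma sized_linkIn (F : Finset (Finset α)) (Z : Finset α) (v : α) (r : ℕ) :
    ((linkIn F Z v r : Finset (Finset α)) : Set (Finset α)).Sized r :=
  fun _ hT => (mem_linkIn.1 hT).1.2

lemma shadow_linkIn_subset {F : Finset (Finset α)} {Z : Finset α} {v : α} (hv : v ∉ Z) (r : ℕ) :
    ∂ (linkIn F Z v (r + 1)) ⊆ linkIn (∂ F) Z v r := by
  intro T hT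
  obtain ⟨a, ha, hT⟩ := mem_shadow_iff_insert_mem.1 hT
  rw [mem_linkIn, card_insert_of_notMem ha] at hT
  obtain ⟨⟨h1, h2⟩, h3⟩ := hT
  refine mem_linkIn.2 ⟨⟨(subset_insert a T).trans h1, by omega⟩,
    mem_shadow_iff_insert_mem.2 ⟨a, ?_, by rwa [insert_comm]⟩⟩
  intro h
  rcases mem_insert.1 h with rfl | h
  · exact hv (h1 (mem_insert_self _ _))
  · exact ha h

lemma card_filter_subset_insert {F : Finset (Finset α)} {Z : Finset α} {v : α} {r : ℕ}
    (hF : (F : Set (Finset α)).Sized (r + 1)) (hv : v ∉ Z) :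
    #({R ∈ F | R ⊆ insert v Z}) = #({R ∈ F | R ⊆ Z}) + #(linkIn F Z v r) := by
  rw [← card_memberSubfamily_add_card_nonMemberSubfamily v, add_comm]
  congr 2
  · ext T
    rw [mem_nonMemberSubfamily, mem_filter, mem_filter]
    constructor
    · rintro ⟨⟨h1, h2⟩, h3⟩
      exact ⟨h1, (subset_insert_iff_of_notMem h3).1 h2⟩
    · rintro ⟨h1, h2⟩
      exact ⟨⟨h1, h2.trans (subset_insert _ _)⟩, fun h => hv (h2 h)⟩
  · ext T
    rw [mem_memberSubfamily, mem_filter, mem_linkIn]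
    constructor
    · rintro ⟨⟨h1, h2⟩, h3⟩
      have := hF h1
      rw [card_insert_of_notMem h3] at this
      exact ⟨⟨(insert_subset_insert_iff h3).1 h2, by omega⟩, h1⟩
    · rintro ⟨⟨h1, h2⟩, h3⟩
      exact ⟨⟨h3, insert_subset_insert _ h1⟩, fun h => hv (h1 h)⟩

lemma filter_linkIn_subset {F : Finset (Finset α)} {Z X : Finset α} (hZX : Z ⊆ X) (v : α)
    (r : ℕ) : {T ∈ linkIn F X v r | T ⊆ Z} = linkIn F Z v r := by
  ext T
  rw [mem_filter, mem_linkIn, mem_linkIn]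
  exact ⟨fun h => ⟨⟨h.2, h.1.1.2⟩, h.1.2⟩, fun h => ⟨⟨⟨h.1.1.trans hZX, h.1.2⟩, h.2⟩, h.1.1⟩⟩

lemma filter_linkIn_self {F : Finset (Finset α)} (X : Finset α) (v : α) (r : ℕ) :
    {T ∈ linkIn F X v r | T ⊆ X} = linkIn F X v r :=
  filter_true_of_mem fun _ hT => (mem_linkIn.1 hT).1.1

lemma linkIn_subset_filter_shadow {F : Finset (Finset α)} {Z : Finset α} {v : α} (hv : v ∉ Z)
    (r : ℕ) : linkIn F Z v r ⊆ {T ∈ ∂ F | T ⊆ Z} := by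
  intro T hT
  rw [mem_linkIn] at hT
  exact mem_filter.2 ⟨mem_shadow_iff_insert_mem.2 ⟨v, fun h => hv (hT.1.1 h), hT.2⟩, hT.1.1⟩

lemma linkIn_linkIn_subset {F : Finset (Finset α)} {Z : Finset α} {u v : α} (hv : v ∉ insert u Z)
    (r : ℕ) : linkIn (linkIn F (insert u Z) v (r + 1)) Z u r ⊆ linkIn (∂ F) Z u r := by
  intro T hT
  rw [mem_linkIn, mem_linkIn] at hT
  exact mem_linkIn.2 ⟨hT.1, mem_shadow_iff_insert_mem.2 ⟨v, fun h => hv (hT.2.1.1 h), hT.2.2⟩⟩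

end Link

variable {N l i : ℕ}

namespace ShadowProfile

variable (S : ShadowProfile N l i)

/-- The complements of `M` number at most a = C(n-3,i+2), so their shadow is larger by a factor of
at least (i+2)/(l+1) = 1/σ; that shadow complements k-sets missing from `R`. -/
lemma card_missing_le {Z : Finset (Fin N)} (hZ : #Z = l + i + 4) {R M : Finset (Finset (Fin N))}
    (hR : R ⊆ Z.powersetCard (l + 3)) (hM : M ⊆ Z.powersetCard (l + 2) \ ∂ R)
    (hMa : (#M : ℝ) ≤ S.a) :
    (#M : ℝ) ≤ S.σ * ((l + i + 4).choose (l + 3) - #R) := by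
  obtain ⟨T, hT, hTM, hs⟩ := exists_compl_family (r := l + 2) (s := i + 2) hR
    (by rw [hZ]; ring) hM
  have e : l + 2 + (i + 2) = l + i + 4 := by ring
  rw [e] at hs
  have hs' : (#(∂ T) : ℝ) + #R ≤ (l + i + 4).choose (l + 3) := by exact_mod_cast hs
  have h1 := real_card_mul_le_card_shadow_mul (r := i + 1) (x := ((l + i + 2 : ℕ) : ℝ)) hT
    (by push_cast; linarith [(Nat.cast_nonneg l : (0 : ℝ) ≤ l)]) (by
      rw [Ring.choose_natCast, hTM]
      have : (l + i + 2).choose (i + 1 + 1) = (l + i + 2).choose l := by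
        rw [← Nat.choose_symm_of_eq_add (show l + i + 2 = (i + 1 + 1) + l by ring)]
      rw [this]
      exact hMa.trans_eq S.ha)
  rw [hTM] at h1
  push_cast at h1
  have h2 : (#M : ℝ) * (i + 2) ≤ (S.σ * ((l + i + 4).choose (l + 3) - #R)) * (i + 2) := by
    have h3 : (#(∂ T) : ℝ) * (l + 1) ≤ ((l + i + 4).choose (l + 3) - #R) * (l + 1) :=
      mul_le_mul_of_nonneg_right (by linarith) (by positivity)
    rw [← S.hσ] at h3
    have h4 : (#(∂ T) : ℝ) * (l + 1) = #(∂ T) * (S.σ * (i + 2)) := by rw [S.hσ]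
    have h5 : (#M : ℝ) * (i + 1 + 1) ≤ #(∂ T) * (l + 1) := by
      refine h1.trans_eq ?_
      ring
    linarith
  exact le_of_mul_le_mul_right h2 (by positivity)

lemma c_le_b_of_b_le_a (h : S.b ≤ S.a) : S.c ≤ S.b := by
  have h1 : S.c * (l + 2) = S.b * (i + 1) := by
    rw [S.hc, S.hb]
    have := Nat.choose_succ_right_eq (l + i + 2) (l + 1)
    rw [show l + i + 2 - (l + 1) = i + 1 by omega] at this
    exact_mod_cast this
  have hb := S.hb_pos
  have h2 : 1 ≤ S.σ := by
    rw [← S.hσb] at h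
    by_contra h'
    have := mul_lt_mul_of_pos_right (not_le.1 h') hb
    linarith
  have h3 : (i : ℝ) + 2 ≤ l + 1 := by
    rw [← S.hσ]
    have := mul_le_mul_of_nonneg_right h2 (show (0 : ℝ) ≤ i + 2 by positivity)
    linarith
  have h4 : S.c * (l + 2) ≤ S.b * (l + 2) := by
    rw [h1]
    exact mul_le_mul_of_nonneg_left (by linarith) hb.le
  exact le_of_mul_le_mul_right h4 (by positivity)

lemma choose_eq : ((l + i + 4).choose (l + 2) : ℝ) = S.c + 2 * S.b + S.a := by
  rw [S.ha, S.hb, S.hc]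
  have h1 : (l + i + 4).choose (l + 2) = (l + i + 3).choose (l + 1) + (l + i + 3).choose (l + 2) :=
    Nat.choose_succ_succ _ _
  have h2 : (l + i + 3).choose (l + 1) = (l + i + 2).choose l + (l + i + 2).choose (l + 1) :=
    Nat.choose_succ_succ _ _
  have h3 : (l + i + 3).choose (l + 2) = (l + i + 2).choose (l + 1) + (l + i + 2).choose (l + 2) :=
    Nat.choose_succ_succ _ _
  rw [h1, h2, h3]
  push_cast
  ring

/-- The arithmetic behind `le_card_shadow_of_two_centres`. -/
lemma le_of_two_centres {P : Finset (Finset (Fin N))}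
    (hP : (P : Set (Finset (Fin N))).Sized (l + 2)) {Q W d o M₁ ρ ω : ℝ} (hQP : Q ≤ #P)
    (hd : 0 ≤ d) (ho : 0 ≤ o) (hW : W ≤ #P + Q)
    (hM₁ : 0 ≤ M₁) (hρ₀ : ρ ≤ S.c + 2 * S.b + S.a - W) (hρ₁ : ρ ≤ S.a → ρ ≤ S.σ * M₁)
    (hcard : S.p + S.q ≤ #P - M₁ + (Q + d + o)) (hout : S.q ≤ Q + d + o)
    (hlt : #P + Q + d + o < W + S.q)
    (hω₁ : S.c + S.b ≤ #P - M₁ → S.c + 2 * S.b + S.a + S.H (#P - M₁) ≤ ω)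
    (hω₂ : S.c + 2 * S.b + S.a - ρ + #(∂ P) ≤ ω) (hω₃ : S.c + 2 * S.b + S.a - ρ + d ≤ ω) :
    S.c + 2 * S.b + S.a + S.D + S.L ≤ ω + (S.H (Q + d) + S.H o) := by
  have hpc := S.hp
  have hpc' := S.hp'
  have hLb := S.hLb
  have hσb := S.hσb
  -- `hcard` and `hlt` give p + M₁ < W, hence ρ < a - M₁.
  have hρa : ρ ≤ S.a := by linarith
  have hρ₁ := hρ₁ hρa
  have hb := S.hb_pos
  by_cases hQ : 0 ≤ Q + d
  swap
  · linarith [S.hqpos, ho]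
  have hω : S.c + 2 * S.b + S.a + S.H (#P - M₁) ≤ ω := by
    rcases le_or_gt (S.c + S.b) (#P - M₁) with h | h
    · exact hω₁ h
    · have := S.H_add_le_card_shadow hP rfl hM₁ hρ₁ hρa h.le
      linarith
  have hHadd := S.H_add_le_add hQ ho
  rcases le_or_gt S.p (#P - M₁) with h1 | h1
  · have := S.D_add_L_le (u := #P - M₁) hout hcard (Or.inr h1)
    linarith
  rcases le_or_gt (Q + d + o) S.p with h2 | h2
  · have := S.D_add_L_le (u := #P - M₁) hout hcard (Or.inl h2)
    linarith
  rcases le_or_gt S.q (#P - M₁) with h3 | h3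
  · have := S.L_le_H h3
    have := S.D_le_H h2.le
    linarith
  rcases le_or_gt S.b S.a with h4 | h4
  · have hcb := S.c_le_b_of_b_le_a h4
    -- Here |P| ≥ W/2 > (c + 2b + M₁)/2 ≥ c + t since c ≤ b, and ρ ≤ σt averages ρ ≤ σM₁ with ρ ≤ a
    -- = σb.
    have := S.b_add_le_card_shadow hP (t := (S.b + M₁) / 2) (ρ := ρ) (by linarith) (by linarith)
      (by linarith) hρa
    have := S.D_le_H h2.le
    linarith
  rcases le_or_gt (Q + d) S.p with h5 | h5
  -- Below q the slope is exactly `μ`, and elsewhere at most `μ`: shifting all but q of the mass of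
  -- `P - M₁` and `o` onto `Q + d` does not increase the sum, and leaves L + D.
  · have h6 := S.le_H_of_le h3.le
    have h7 := S.le_H_of_le (z := o) (by linarith)
    have h8 := S.H_add_le (u := Q + d) (w := #P - M₁ + o - S.q) (by linarith)
    have h9 := S.D_le_H (z := Q + d + (#P - M₁ + o - S.q)) (by linarith)
    have := S.hμ
    linarith
  · have h6 := S.D_le_H h5.le
    have h7 := S.H_nonneg ho
    have h8 : S.σ * M₁ ≤ M₁ := by
      have : S.σ ≤ 1 := by
        by_contra h
        have := mul_lt_mul_of_pos_right (not_le.1 h) hb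
        linarith
      have := mul_le_mul_of_nonneg_right this hM₁
      linarith
    -- A large `d` is enough by `hω₃`. Otherwise |P| ≥ Q > c + b - ρ, while ρ ≤ M₁ and ρ + M₁ < a <
    -- b give ρ < a/2 < b/2.
    rcases le_or_gt (S.b + ρ) d with h9 | h9
    · linarith
    · have := S.b_add_le_card_shadow hP (t := S.b / 2) (ρ := ρ) (by linarith) (by linarith)
        (by linarith) hρa
      linarith

/-- By `hlt`, merging the links of `u` and `v` over `Z` would leave fewer than q members outside
`insert u Z`. The shadow is split into sets inside `insert u Z`, those through `v` over it, and
those outside both centres. -/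
theorem le_card_shadow_of_two_centres {F : Finset (Finset (Fin N))}
    (hF : (F : Set (Finset (Fin N))).Sized (l + 3)) {Z : Finset (Fin N)} (hZ : #Z = l + i + 4)
    {u v : Fin N} (hu : u ∉ Z) (hv : v ∉ Z) (huv : v ≠ u)
    (hcard : ((l + i + 4).choose (l + 3) : ℝ) + S.p + S.q ≤ #F)
    (hout : S.q ≤ #({R ∈ F | ¬ R ⊆ insert u Z}))
    (hlt : (#F : ℝ) < #({R ∈ F | R ⊆ Z}) +
      #(linkIn F Z u (l + 2) ∪ linkIn F Z v (l + 2)) + S.q)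
    (hle : #(linkIn F Z v (l + 2)) ≤ #(linkIn F Z u (l + 2))) :
    ((l + i + 4).choose (l + 2) : ℝ) + S.D + S.L ≤ #(∂ F) := by
  have hvX : v ∉ insert u Z := by simp [huv, hv]
  have hF' : ((∂ F : Finset (Finset (Fin N))) : Set (Finset (Fin N))).Sized (l + 1 + 1) :=
    hF.shadow
  set P := linkIn F Z u (l + 2) with hP
  set Q := linkIn F Z v (l + 2) with hQ
  set R := {R ∈ F | R ⊆ Z} with hR
  set E := linkIn F (insert u Z) v (l + 2) with hE
  set J := linkIn E Z u (l + 1) with hJ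
  have c1 : #({R ∈ F | R ⊆ insert u Z}) = #R + #P := card_filter_subset_insert hF hu
  have c2 : #({R ∈ F | R ⊆ insert v (insert u Z)}) = #({R ∈ F | R ⊆ insert u Z}) + #E :=
    card_filter_subset_insert hF hvX
  have c3 : #E = #Q + #J := by
    have := card_filter_subset_insert (sized_linkIn F (insert u Z) v (l + 1 + 1)) hu
    rwa [filter_linkIn_self, filter_linkIn_subset (subset_insert u Z)] at this
  have c4 := card_filter_add_card_filter_not (s := F) (· ⊆ insert u Z)
  have c5 := card_filter_add_card_filter_not (s := F) (· ⊆ insert v (insert u Z))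
  have d1 : #({T ∈ ∂ F | T ⊆ insert u Z}) = #({T ∈ ∂ F | T ⊆ Z}) + #(linkIn (∂ F) Z u (l + 1)) :=
    card_filter_subset_insert hF' hu
  have d2 : #({T ∈ ∂ F | T ⊆ insert v (insert u Z)}) =
      #({T ∈ ∂ F | T ⊆ insert u Z}) + #(linkIn (∂ F) (insert u Z) v (l + 1)) :=
    card_filter_subset_insert hF' hvX
  have d3 := card_shadow_inside_add_outside F (insert v (insert u Z))
  have d4 := S.H_le_outside F hF (insert v (insert u Z))
  have d5 : #(∂ E) ≤ #(linkIn (∂ F) (insert u Z) v (l + 1)) :=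
    card_le_card (shadow_linkIn_subset hvX (l + 1))
  have d6 : S.H #E ≤ #(∂ E) := S.le_shadow E (sized_linkIn _ _ _ _)
  have d7 : #(∂ P) ≤ #(linkIn (∂ F) Z u (l + 1)) := card_le_card (shadow_linkIn_subset hu (l + 1))
  have d8 : #J ≤ #(linkIn (∂ F) Z u (l + 1)) := card_le_card (linkIn_linkIn_subset hvX (l + 1))
  have hRZ : R ⊆ Z.powersetCard (l + 3) := fun T hT => by
    rw [hR, mem_filter] at hT
    exact mem_powersetCard.2 ⟨hT.2, hF hT.1⟩
  have hRc : #R ≤ (l + i + 4).choose (l + 3) := by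
    rw [← hZ, ← card_powersetCard]; exact card_le_card hRZ
  -- All of `P`, `Q` and `∂ R` lies in `∂ F`, so `K` bounds what the shadow can miss inside `Z`.
  set K := Z.powersetCard (l + 2) \ ((P ∪ Q) ∪ ∂ R) with hK
  have hPZ : P ∪ Q ⊆ Z.powersetCard (l + 2) :=
    union_subset (filter_subset _ _) (filter_subset _ _)
  have hRsub : ∂ R ⊆ Z.powersetCard (l + 2) := by
    intro T hT
    obtain ⟨A, hA, hTA⟩ := exists_subset_of_mem_shadow hT
    exact mem_powersetCard.2 ⟨hTA.trans (mem_powersetCard.1 (hRZ hA)).1,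
      hF' (shadow_mono (filter_subset _ _) hT)⟩
  have hKc : #K + #((P ∪ Q) ∪ ∂ R) = (l + i + 4).choose (l + 2) := by
    rw [hK, card_sdiff_add_card_eq_card (union_subset hPZ hRsub), card_powersetCard, hZ]
  have hsub : #((P ∪ Q) ∪ ∂ R) ≤ #({T ∈ ∂ F | T ⊆ Z}) := by
    refine card_le_card (union_subset (union_subset (linkIn_subset_filter_shadow hu _)
      (linkIn_subset_filter_shadow hv _)) fun T hT => mem_filter.2
        ⟨shadow_mono (filter_subset _ _) hT, (mem_powersetCard.1 (hRsub hT)).1⟩)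
  have hPQ : #(P ∪ Q) ≤ #((P ∪ Q) ∪ ∂ R) := card_le_card subset_union_left
  have hPQ' : #(P ∪ Q) ≤ #P + #Q := card_union_le _ _
  have hmiss := S.card_missing_le hZ hRZ (M := K)
    (sdiff_subset_sdiff subset_rfl subset_union_right)
  have hin := S.le_shadow_of_subset (insert u Z) {R ∈ F | R ⊆ insert u Z}
    (by rw [card_insert_of_notMem hu, hZ]) (fun T hT => by
      rw [mem_filter] at hT
      exact mem_powersetCard.2 ⟨hT.2, hF hT.1⟩)
  have hin' : #(∂ {R ∈ F | R ⊆ insert u Z}) ≤ #({T ∈ ∂ F | T ⊆ insert u Z}) := by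
    refine card_le_card fun T hT => mem_filter.2 ⟨shadow_mono (filter_subset _ _) hT, ?_⟩
    obtain ⟨A, hA, hTA⟩ := exists_subset_of_mem_shadow hT
    exact hTA.trans (mem_filter.1 hA).2
  set o := #({R ∈ F | ¬ R ⊆ insert v (insert u Z)}) with ho
  have key := S.le_of_two_centres (P := P) (sized_linkIn _ _ _ _) (Q := #Q) (W := #(P ∪ Q))
    (d := #J) (o := o) (M₁ := (l + i + 4).choose (l + 3) - #R) (ρ := #K)
    (ω := #({T ∈ ∂ F | T ⊆ insert u Z})) (by exact_mod_cast hle) (by positivity) (by positivity)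
    (by exact_mod_cast hPQ') (by rw [sub_nonneg]; exact_mod_cast hRc)
  rw [← S.choose_eq] at key
  have hFc : (#F : ℝ) = #R + #P + (#Q + #J + o) := by
    norm_cast
    omega
  have houtc : (#({R ∈ F | ¬ R ⊆ insert u Z}) : ℝ) = #Q + #J + o := by
    norm_cast
    omega
  have hKc' : (#K : ℝ) + #((P ∪ Q) ∪ ∂ R) = (l + i + 4).choose (l + 2) := by exact_mod_cast hKc
  have hPQr : (#(P ∪ Q) : ℝ) ≤ #((P ∪ Q) ∪ ∂ R) := by exact_mod_cast hPQ
  have hsubr : (#((P ∪ Q) ∪ ∂ R) : ℝ) ≤ #({T ∈ ∂ F | T ⊆ Z}) := by exact_mod_cast hsub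
  have d1r : (#({T ∈ ∂ F | T ⊆ insert u Z}) : ℝ) =
    #({T ∈ ∂ F | T ⊆ Z}) + #(linkIn (∂ F) Z u (l + 1)) := by exact_mod_cast d1
  have d7r : (#(∂ P) : ℝ) ≤ #(linkIn (∂ F) Z u (l + 1)) := by exact_mod_cast d7
  have d8r : (#J : ℝ) ≤ #(linkIn (∂ F) Z u (l + 1)) := by exact_mod_cast d8
  have key2 := key (by linarith) hmiss (by linarith) (by linarith) (by linarith) (by
    intro h
    have e1 : (#({R ∈ F | R ⊆ insert u Z}) : ℝ) = #R + #P := by exact_mod_cast c1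
    have e2 := hin (by linarith)
    have e3 : (#(∂ {R ∈ F | R ⊆ insert u Z}) : ℝ) ≤ #({T ∈ ∂ F | T ⊆ insert u Z}) := by
      exact_mod_cast hin'
    rw [e1] at e2
    have e4 : (#P : ℝ) - ((l + i + 4).choose (l + 3) - #R) =
      #R + #P - (l + i + 4).choose (l + 3) := by ring
    rw [e4]
    exact e2.trans e3) (by linarith) (by linarith)
  have c3r : (#E : ℝ) = #Q + #J := by exact_mod_cast c3
  have d2r : (#({T ∈ ∂ F | T ⊆ insert v (insert u Z)}) : ℝ) =
      #({T ∈ ∂ F | T ⊆ insert u Z}) + #(linkIn (∂ F) (insert u Z) v (l + 1)) := by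
    exact_mod_cast d2
  have d3r : (#({T ∈ ∂ F | T ⊆ insert v (insert u Z)}) : ℝ) +
      #({T ∈ ∂ ({R ∈ F | ¬ R ⊆ insert v (insert u Z)}) | ¬ Disjoint T (insert v (insert u Z))ᶜ}) ≤
      #(∂ F) := by exact_mod_cast d3
  have d5r : (#(∂ E) : ℝ) ≤ #(linkIn (∂ F) (insert u Z) v (l + 1)) := by exact_mod_cast d5
  rw [c3r] at d6
  linarith

end ShadowProfile

end Finset

/-! ### Compressions and the induction on colex weight. -/

namespace Finset

open scoped FinsetFamily

section Compression

variable {α : Type*} [LinearOrder α] {U V : Finset α} {F : Finset (Finset α)}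

/-- The `(U, V)`-compressions that decrease the measure of a family. -/
def IsDownCompression (U V : Finset α) : Prop :=
  Disjoint U V ∧ #U = #V ∧ ∃ (hU : U.Nonempty) (hV : V.Nonempty), max' U hU < max' V hV

lemma isDownCompression_singleton {u v : α} (h : u < v) : IsDownCompression {u} {v} :=
  ⟨disjoint_singleton.2 h.ne, rfl, singleton_nonempty u, singleton_nonempty v, by
    simpa using h⟩

lemma isDownCompression_erase {u v : α} (hU : U.Nonempty) (hV : V.Nonempty) (hd : Disjoint U V)
    (hcard : #U = #V) (hlt : max' U hU < max' V hV) (h2 : 1 < #U) (hu : u ∈ U) (hv : v ∈ V)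
    (hvmax : v ≠ max' V hV) : IsDownCompression (U.erase u) (V.erase v) := by
  have hU' : (U.erase u).Nonempty := by
    rw [← card_pos, card_erase_of_mem hu]; omega
  have hV' : (V.erase v).Nonempty := by
    rw [← card_pos, card_erase_of_mem hv]; omega
  refine ⟨hd.mono (erase_subset _ _) (erase_subset _ _), ?_, hU', hV', ?_⟩
  · rw [card_erase_of_mem hu, card_erase_of_mem hv, hcard]
  · exact (max'_subset hU' (erase_subset _ _)).trans_lt
      (hlt.trans_le (le_max' _ _ (mem_erase.2 ⟨hvmax.symm, max'_mem V hV⟩)))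

lemma _root_.UV.IsCompressed.union_sdiff_mem {B : Finset α} (h : UV.IsCompressed U V F)
    (hB : B ∈ F) (hV : V ⊆ B) (hU : Disjoint U B) : (B ∪ U) \ V ∈ F :=
  UV.sup_sdiff_mem_of_mem_compression (h.symm ▸ hB) hV hU

lemma card_shadow_compression_le_of_isDownCompression (h₁ : IsDownCompression U V)
    (h₂ : ∀ ⦃U₁ V₁⦄, IsDownCompression U₁ V₁ → #U₁ < #U → UV.IsCompressed U₁ V₁ F) :
    #(∂ (UV.compression U V F)) ≤ #(∂ F) := by
  obtain ⟨hd, hcard, hU, hV, hlt⟩ := h₁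
  refine UV.card_shadow_compression_le _ _ fun x hx ↦ ⟨min' V hV, min'_mem _ _, ?_⟩
  rcases eq_or_lt_of_le (Nat.succ_le_of_lt hU.card_pos) with h | h
  · have h1 : erase U x = ∅ := by rw [← card_eq_zero, card_erase_of_mem hx, ← h]
    have h2 : erase V (min' V hV) = ∅ := by
      rw [← card_eq_zero, card_erase_of_mem (min'_mem _ _), ← hcard, ← h]
    rw [h1, h2]
    exact UV.isCompressed_self _ _
  · exact h₂ (isDownCompression_erase hU hV hd hcard hlt h hx (min'_mem _ _)
      (min'_lt_max'_of_card V (hcard ▸ h)).ne) (card_erase_lt_of_mem hx)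

lemma isInitSeg_of_forall_isCompressed {r : ℕ} (h₁ : (F : Set (Finset α)).Sized r)
    (h₂ : ∀ U V, IsDownCompression U V → UV.IsCompressed U V F) : Colex.IsInitSeg F r := by
  refine ⟨h₁, ?_⟩
  rintro A B hA ⟨hBA, sizeA⟩
  by_contra hB
  have hAB : A ≠ B := ne_of_mem_of_not_mem hA hB
  have hAB' : #A = #B := (h₁ hA).trans sizeA.symm
  have hU : (A \ B).Nonempty := sdiff_nonempty.2 fun h ↦ hAB <| eq_of_subset_of_card_le h hAB'.ge
  have hV : (B \ A).Nonempty :=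
    sdiff_nonempty.2 fun h ↦ hAB.symm <| eq_of_subset_of_card_le h hAB'.le
  have disj : Disjoint (B \ A) (A \ B) := disjoint_sdiff.mono_left sdiff_subset
  have smaller : max' _ hV < max' _ hU := by
    obtain hlt | heq | hgt := lt_trichotomy (max' _ hU) (max' _ hV)
    · rw [← UV.compress_sdiff_sdiff A B] at hAB hBA
      cases hBA.not_gt <| UV.toColex_compress_lt_toColex hlt hAB
    · exact (disjoint_right.1 disj (max'_mem _ hU) <| heq.symm ▸ max'_mem _ _).elim
    · assumption
  refine hB ?_
  rw [← (h₂ _ _ ⟨disj, card_sdiff_comm hAB'.symm, hV, hU, smaller⟩).eq]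
  exact UV.mem_compression.2 (Or.inr ⟨hB, A, hA, UV.compress_sdiff_sdiff _ _⟩)

lemma sum_compression_lt {M : Type*} [AddCommMonoid M] [PartialOrder M] [IsOrderedCancelAddMonoid M]
    {w : Finset α → M} (hw : ∀ A B : Finset α, toColex A < toColex B → w A < w B)
    (h : IsDownCompression U V) (hF : ¬ UV.IsCompressed U V F) :
    ∑ A ∈ UV.compression U V F, w A < ∑ A ∈ F, w A := by
  obtain ⟨-, -, hU, hV, hlt⟩ := h
  change UV.compression U V F ≠ F at hF
  rw [UV.compression] at hF ⊢
  have q : ∀ Q ∈ {A ∈ F | UV.compress U V A ∉ F}, UV.compress U V Q ≠ Q := by grind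
  have uA : {A ∈ F | UV.compress U V A ∈ F} ∪ {A ∈ F | UV.compress U V A ∉ F} = F :=
    filter_union_filter_not_eq _ _
  have ne₂ : {A ∈ F | UV.compress U V A ∉ F}.Nonempty := by
    contrapose! hF
    rw [filter_image, hF, image_empty, union_empty]
    rwa [hF, union_empty] at uA
  rw [sum_union UV.compress_disjoint]
  conv_rhs => rw [← uA]
  rw [sum_union (disjoint_filter_filter_not _ _ _), add_lt_add_iff_left, filter_image,
    sum_image UV.compress_injOn]
  exact sum_lt_sum_of_nonempty ne₂ fun A hA ↦ hw _ _ (UV.toColex_compress_lt_toColex hlt (q _ hA))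

/-- Compressing with `V ⊆ X` does not increase the number of members contained in `X`. -/
lemma card_filter_compression_subset_le {X : Finset α} (hV : V ⊆ X) :
    #({R ∈ UV.compression U V F | R ⊆ X}) ≤ #({R ∈ F | R ⊆ X}) := by
  refine card_le_card_of_injOn (fun R => if R ∈ F then R else (R ∪ V) \ U) ?_ ?_
  · intro R hR
    rw [mem_coe, mem_filter] at hR
    rw [mem_coe, mem_filter]
    dsimp only
    split_ifs with h
    · exact ⟨h, hR.2⟩
    · exact ⟨UV.sup_sdiff_mem_of_mem_compression_of_notMem hR.1 h,
        sdiff_subset.trans (union_subset hR.2 hV)⟩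
  · have key : ∀ R ∈ UV.compression U V F, R ∉ F → UV.compress U V ((R ∪ V) \ U) = R :=
      fun R hR h => UV.compress_of_disjoint_of_le' (UV.disjoint_of_mem_compression_of_notMem hR h)
        (UV.le_of_mem_compression_of_notMem hR h)
    have key2 : ∀ R ∈ UV.compression U V F, R ∈ F → ∀ T ∈ UV.compression U V F, T ∉ F →
        R ≠ (T ∪ V) \ U := by
      rintro R hR hRF T hT hTF rfl
      rcases UV.mem_compression.1 hR with h | h
      · rw [key T hT hTF] at h
        exact hTF h.2
      · exact h.1 hRF
    intro R hR T hT h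
    rw [mem_coe, mem_filter] at hR hT
    dsimp only at h
    split_ifs at h with h1 h2 h2
    · exact h
    · exact absurd h (key2 R hR.1 h1 T hT.1 h2)
    · exact absurd h.symm (key2 T hT.1 h2 R hR.1 h1)
    · rw [← key R hR.1 h1, ← key T hT.1 h2, h]

/-- If a minimal compression with `1 < #U` moves a set into `X`, then every element of `V` below
the maximum of `V` lies in `X`, unless a translate of `X` contains many members of `F`. -/
lemma exists_card_filter_compression_subset_le {X S : Finset α} (hU : U.Nonempty)
    (hV : V.Nonempty) (hd : Disjoint U V) (hcard : #U = #V) (hlt : max' U hU < max' V hV)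
    (h2 : 1 < #U)
    (hmin : ∀ ⦃U₁ V₁⦄, IsDownCompression U₁ V₁ → #U₁ < #U → UV.IsCompressed U₁ V₁ F)
    (hS : S ∈ UV.compression U V F) (hSX : S ⊆ X) (hSF : S ∉ F) {v : α} (hv : v ∈ V)
    (hvmax : v ≠ max' V hV) (hvX : v ∉ X) :
    ∃ X₂ : Finset α, #X₂ = #X ∧
      #({R ∈ UV.compression U V F | R ⊆ X}) ≤ #({R ∈ F | R ⊆ X₂}) := by
  obtain ⟨u, hu⟩ : ∃ u, u = max' U hU := ⟨_, rfl⟩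
  have huU : u ∈ U := hu ▸ max'_mem U hU
  have huV : u ∉ V := disjoint_left.1 hd huU
  have hvU : v ∉ U := disjoint_right.1 hd hv
  have huv : u ≠ v := fun h => huV (h ▸ hv)
  have hlt1 : #(U.erase u) < #U := card_erase_lt_of_mem huU
  have hE := hmin (isDownCompression_erase hU hV hd hcard hlt h2 huU hv hvmax) hlt1
  have move : ∀ R ∈ UV.compression U V F, R ∉ F →
      U ⊆ R ∧ Disjoint V R ∧ (R ∪ V) \ U ∈ F := fun R hR h =>
    ⟨UV.le_of_mem_compression_of_notMem hR h, UV.disjoint_of_mem_compression_of_notMem hR h,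
      UV.sup_sdiff_mem_of_mem_compression_of_notMem hR h⟩
  have huX : u ∈ X := hSX ((move S hS hSF).1 huU)
  rcases lt_or_gt_of_ne huv with huv' | huv'
  -- Pull `S` back to `F`, then apply the two smaller compressions {u},{v} and U \ {u}, V \ {v},
  -- both of which fix `F`: this recovers `S`.
  · exfalso
    obtain ⟨h3, h4, h5⟩ := move S hS hSF
    have hC := hmin (isDownCompression_singleton huv') (by rw [card_singleton]; exact h2)
    have h6 := hC.union_sdiff_mem h5 (by
      rw [singleton_subset_iff, mem_sdiff, mem_union]; exact ⟨Or.inr hv, hvU⟩) (by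
      rw [disjoint_singleton_left, mem_sdiff]; exact fun h => h.2 huU)
    have h7 := hE.union_sdiff_mem h6 (by
      intro t ht
      rw [mem_erase] at ht
      have := disjoint_right.1 hd ht.2
      simp [ht.1, ht.2, this]) (by
      rw [disjoint_left]
      intro t ht
      rw [mem_erase] at ht
      simp [ht.1, ht.2])
    refine hSF ?_
    convert h7 using 1
    ext t
    have e1 := @h3 t
    have e2 : t ∈ V → t ∉ S := fun h => disjoint_left.1 h4 h
    have e3 : t ∈ U → t ∉ V := fun h => disjoint_left.1 hd h
    simp only [mem_sdiff, mem_union, mem_erase, mem_singleton]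
    by_cases t = u <;> by_cases t = v <;> grind
  · have hC := hmin (isDownCompression_singleton huv') (by rw [card_singleton]; exact h2)
    -- Exchanging `u` for `v` keeps old members in `F` by the compression {v},{u}, and sends each
    -- new member into `F` through its preimage and the compression U \ {u}, V \ {v}.
    refine ⟨insert v (X.erase u), ?_, ?_⟩
    · rw [card_insert_of_notMem (fun h => hvX (mem_of_mem_erase h)), card_erase_add_one huX]
    refine card_le_card_of_injOn (fun R => if u ∈ R then insert v (R.erase u) else R) ?_ ?_
    · intro R hR
      rw [mem_coe, mem_filter] at hR
      rw [mem_coe, mem_filter]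
      have hvR : v ∉ R := fun h => hvX (hR.2 h)
      dsimp only
      split_ifs with h
      · refine ⟨?_, insert_subset_insert _ (erase_subset_erase _ hR.2)⟩
        by_cases hRF : R ∈ F
        · have h6 := hC.union_sdiff_mem hRF (singleton_subset_iff.2 h)
            (disjoint_singleton_left.2 hvR)
          convert h6 using 1
          ext t
          simp only [mem_insert, mem_erase, mem_sdiff, mem_union, mem_singleton]
          grind
        · obtain ⟨h3, h4, h5⟩ := move R hR.1 hRF
          have h7 := hE.union_sdiff_mem h5 (by
            intro t ht
            rw [mem_erase] at ht
            have := disjoint_right.1 hd ht.2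
            simp [ht.2, this]) (by
            rw [disjoint_left]
            intro t ht
            rw [mem_erase] at ht
            simp [ht.2])
          convert h7 using 1
          ext t
          have e1 := @h3 t
          have e2 : t ∈ V → t ∉ R := fun h => disjoint_left.1 h4 h
          have e3 : t ∈ U → t ∉ V := fun h => disjoint_left.1 hd h
          simp only [mem_insert, mem_sdiff, mem_union, mem_erase]
          by_cases t = u <;> by_cases t = v <;> grind
      · have hRF : R ∈ F := by
          by_contra hRF
          exact h ((move R hR.1 hRF).1 huU)
        exact ⟨hRF, fun t ht => mem_insert_of_mem
          (mem_erase.2 ⟨fun e => h (e ▸ ht), hR.2 ht⟩)⟩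
    · intro R hR T hT h
      rw [mem_coe, mem_filter] at hR hT
      have hvR : v ∉ R := fun h => hvX (hR.2 h)
      have hvT : v ∉ T := fun h => hvX (hT.2 h)
      dsimp only at h
      split_ifs at h with h1 h2 h2
      · have := congrArg (fun A => insert u (A.erase v)) h
        simp only [erase_insert (fun h => hvR (mem_of_mem_erase h)),
          erase_insert (fun h => hvT (mem_of_mem_erase h)), insert_erase h1, insert_erase h2]
          at this
        exact this
      · exact absurd (h ▸ mem_insert_self v _) hvT
      · exact absurd (h ▸ mem_insert_self v _) hvR
      · exact h

/-- New members contain two fixed points of `U` and avoid a point of `V` in `X`, so three points of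
`X` are decided. -/
lemma card_filter_subset_notMem_le {X : Finset α} {m r : ℕ} (hX : #X = m + 3)
    (hC : ((UV.compression U V F : Finset (Finset α)) : Set (Finset α)).Sized (r + 2))
    (hd : Disjoint U V) (h2 : 1 < #U) {v : α} (hv : v ∈ V) (hvX : v ∈ X) :
    #({R ∈ UV.compression U V F | R ⊆ X ∧ R ∉ F}) ≤ m.choose r := by
  rcases ({R ∈ UV.compression U V F | R ⊆ X ∧ R ∉ F} : Finset (Finset α)).eq_empty_or_nonempty
    with he | ⟨S, hS⟩
  · rw [he, card_empty]; exact Nat.zero_le _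
  rw [mem_filter] at hS
  have hUX : U ⊆ X := Subset.trans (UV.le_of_mem_compression_of_notMem hS.1 hS.2.2) hS.2.1
  obtain ⟨W, hWU, hW⟩ := exists_subset_card_eq h2
  have hvW : v ∉ W := fun h => disjoint_left.1 hd (hWU h) hv
  have hcX : #(X \ insert v W) = m := by
    rw [card_sdiff_of_subset (insert_subset hvX (hWU.trans hUX)), card_insert_of_notMem hvW]
    omega
  have hsub : ∀ R ∈ ({R ∈ UV.compression U V F | R ⊆ X ∧ R ∉ F} : Finset (Finset α)), W ⊆ R := by
    intro R hR
    rw [mem_filter] at hR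
    exact hWU.trans (UV.le_of_mem_compression_of_notMem hR.1 hR.2.2)
  rw [← hcX, ← card_powersetCard]
  refine card_le_card_of_injOn (· \ W) ?_ ?_
  · intro R hR
    have hWR := hsub R hR
    rw [mem_coe, mem_filter] at hR
    rw [mem_coe, mem_powersetCard, card_sdiff_of_subset hWR, hC hR.1]
    refine ⟨fun t ht => ?_, by omega⟩
    rw [mem_sdiff] at ht ⊢
    refine ⟨hR.2.1 ht.1, fun h => ?_⟩
    rcases mem_insert.1 h with rfl | h
    · exact disjoint_left.1 (UV.disjoint_of_mem_compression_of_notMem hR.1 hR.2.2) hv ht.1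
    · exact ht.2 h
  · intro R hR T hT h
    rw [← sdiff_union_of_subset (hsub R hR), ← sdiff_union_of_subset (hsub T hT)]
    exact congrArg (· ∪ W) h

lemma card_filter_compression_singleton_subset_le {Z : Finset α} {u v : α} {r : ℕ}
    (hC : ((UV.compression {u} {v} F : Finset (Finset α)) : Set (Finset α)).Sized (r + 1))
    (hu : u ∉ Z) (huv : u ≠ v) :
    #({R ∈ UV.compression {u} {v} F | R ⊆ insert u Z}) ≤
      #({R ∈ F | R ⊆ Z}) + #(linkIn F Z u r ∪ linkIn F Z v r) := by
  rw [card_filter_subset_insert hC hu]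
  refine add_le_add (card_le_card fun R hR => ?_) (card_le_card fun T hT => ?_)
  · rw [mem_filter] at hR ⊢
    refine ⟨?_, hR.2⟩
    by_contra hRF
    exact hu (hR.2 (UV.le_of_mem_compression_of_notMem hR.1 hRF (mem_singleton_self u)))
  · rw [mem_linkIn] at hT
    have huT : u ∉ T := fun h => hu (hT.1.1 h)
    rw [mem_union, mem_linkIn, mem_linkIn]
    by_cases hTF : insert u T ∈ F
    · exact Or.inl ⟨hT.1, hTF⟩
    · refine Or.inr ⟨hT.1, ?_⟩
      have := UV.sup_sdiff_mem_of_mem_compression_of_notMem hT.2 hTF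
      convert this using 1
      ext t
      simp only [mem_insert, sup_eq_union, mem_sdiff, mem_union, mem_singleton]
      by_cases t = u <;> grind

end Compression

variable {N l i : ℕ}

theorem ShadowProfile.le_card_shadow (S : ShadowProfile N l i) (hN : l + i + 5 ≤ N)
    {F : Finset (Finset (Fin N))} (hF : (F : Set (Finset (Fin N))).Sized (l + 3))
    (hcard : ((l + i + 4).choose (l + 3) : ℝ) + S.p + S.q ≤ #F)
    (hdiv : ∀ X : Finset (Fin N), #X = l + i + 5 → S.q ≤ #({R ∈ F | ¬ R ⊆ X})) :
    ((l + i + 4).choose (l + 2) : ℝ) + S.D + S.L ≤ #(∂ F) := by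
  -- The binary weight is strictly increasing in colex order, so each compression that moves `F`
  -- lowers it.
  obtain ⟨w, hw⟩ : ∃ w, w = ∑ A ∈ F, ∑ a ∈ A, 2 ^ (a : ℕ) := ⟨_, rfl⟩
  induction w using Nat.strong_induction_on generalizing F with
  | _ w ih =>
  classical
  by_cases hcomp : ∀ U V, IsDownCompression U V → UV.IsCompressed U V F
  · obtain ⟨X, hX, hseg⟩ := exists_isInitSeg_powersetCard (l + 3) hN
    rcases (isInitSeg_of_forall_isCompressed hF hcomp).total hseg with h | h
    · exfalso
      have h1 := hdiv X hX
      rw [filter_false_of_mem fun R hR => not_not.2 (mem_powersetCard.1 (h hR)).1] at h1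
      simp only [card_empty, Nat.cast_zero] at h1
      exact h1.not_gt S.hqpos
    -- Now `F` contains every k-subset of `X`, which suffices because p ≤ C(n-1,k-1).
    · have h1 : (l + i + 5).choose (l + 3) ≤ #({R ∈ F | R ⊆ X}) := by
        rw [← hX, ← card_powersetCard]
        exact card_le_card fun R hR => mem_filter.2 ⟨h hR, (mem_powersetCard.1 hR).1⟩
      have h2 : (l + i + 5).choose (l + 3) =
        (l + i + 4).choose (l + 2) + (l + i + 4).choose (l + 3) := Nat.choose_succ_succ _ _
      have h3 : ((l + i + 4).choose (l + 2) : ℝ) + (l + i + 4).choose (l + 3) ≤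
        #({R ∈ F | R ⊆ X}) := by exact_mod_cast h2 ▸ h1
      rw [S.choose_eq] at h3
      have := S.hp'
      have := S.hb_pos
      have := S.ha_pos
      exact S.le_card_shadow_of_inside hF hX hcard (by linarith) (hdiv X hX)
        (Or.inr (by linarith))
  · obtain ⟨⟨U, V⟩, hUV, hmin⟩ := exists_min_image
      (univ.filter fun t : Finset (Fin N) × Finset (Fin N) =>
        IsDownCompression t.1 t.2 ∧ ¬ UV.IsCompressed t.1 t.2 F) (fun t => #t.1) (by
        push Not at hcomp
        obtain ⟨U, V, h⟩ := hcomp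
        exact ⟨(U, V), mem_filter.2 ⟨mem_univ _, h⟩⟩)
    simp only [mem_filter, mem_univ, true_and] at hUV hmin
    have hmin' : ∀ ⦃U₁ V₁⦄, IsDownCompression U₁ V₁ → #U₁ < #U → UV.IsCompressed U₁ V₁ F := by
      intro U₁ V₁ h1 h2
      by_contra h3
      exact (hmin (U₁, V₁) ⟨h1, h3⟩).not_gt h2
    have hsh := card_shadow_compression_le_of_isDownCompression hUV.1 hmin'
    have hsum := sum_compression_lt (w := fun A : Finset (Fin N) => ∑ a ∈ A, 2 ^ (a : ℕ)) (by
      intro A B hAB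
      simp_rw [← sum_image Fin.val_injective.injOn]
      rw [geomSum_lt_geomSum_iff_toColex_lt_toColex le_rfl,
        Colex.toColex_image_lt_toColex_image Fin.val_strictMono]
      exact hAB) hUV.1 hUV.2
    obtain ⟨hd, hUVc, hU, hV, hlt⟩ := hUV.1
    have hC := hF.uvCompression hUVc
    have hCc := UV.card_compression U V F
    by_cases hdiv' : ∀ X : Finset (Fin N), #X = l + i + 5 →
        S.q ≤ #({R ∈ UV.compression U V F | ¬ R ⊆ X})
    · have := ih _ (hw ▸ hsum) hC (by rw [hCc]; exact hcard) hdiv' rfl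
      exact this.trans (by exact_mod_cast hsh)
    push Not at hdiv'
    obtain ⟨X, hX, hlow⟩ := hdiv'
    -- Compression has put more members inside `X` than any n-set contained before.
    have hin : ∀ X₂ : Finset (Fin N), #X₂ = l + i + 5 →
        #({R ∈ F | R ⊆ X₂}) < #({R ∈ UV.compression U V F | R ⊆ X}) := by
      intro X₂ hX₂
      have h1 := hdiv X₂ hX₂
      have h2 := card_filter_add_card_filter_not (s := F) (· ⊆ X₂)
      have h3 := card_filter_add_card_filter_not (s := UV.compression U V F) (· ⊆ X)
      have h4 : #({R ∈ UV.compression U V F | ¬ R ⊆ X}) < #({R ∈ F | ¬ R ⊆ X₂}) := by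
        exact_mod_cast hlow.trans_le h1
      omega
    have hlow' : (#F : ℝ) < #({R ∈ UV.compression U V F | R ⊆ X}) + S.q := by
      have h3 := card_filter_add_card_filter_not (s := UV.compression U V F) (· ⊆ X)
      rw [hCc] at h3
      rw [← h3]
      push_cast
      linarith
    have hVX : ¬ V ⊆ X := fun h => (card_filter_compression_subset_le h).not_gt (hin X hX)
    obtain ⟨T, hT, hTX, hTF⟩ : ∃ T ∈ UV.compression U V F, T ⊆ X ∧ T ∉ F := by
      by_contra! h
      refine (card_le_card fun R hR => ?_).not_gt (hin X hX)
      rw [mem_filter] at hR ⊢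
      exact ⟨h R hR.1 hR.2, hR.2⟩
    have hUX : U ⊆ X := Subset.trans (UV.le_of_mem_compression_of_notMem hT hTF) hTX
    rcases (Nat.succ_le_of_lt hU.card_pos).eq_or_lt with hU1 | hU2
    · obtain ⟨u, rfl⟩ := card_eq_one.1 hU1.symm
      obtain ⟨v, rfl⟩ := card_eq_one.1 (hUVc ▸ hU1.symm)
      rw [singleton_subset_iff] at hUX hVX
      have huv : u ≠ v := disjoint_singleton.1 hd
      have hX' : insert u (X.erase u) = X := insert_erase hUX
      have hu : u ∉ X.erase u := notMem_erase u X
      have hv : v ∉ X.erase u := fun h => hVX (mem_of_mem_erase h)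
      have hZ : #(X.erase u) = l + i + 4 := by rw [card_erase_of_mem hUX, hX]; rfl
      have hle := card_filter_compression_singleton_subset_le (r := l + 2) hC hu huv
      rw [hX'] at hle
      have hle' : (#({R ∈ UV.compression {u} {v} F | R ⊆ X}) : ℝ) ≤
        #({R ∈ F | R ⊆ X.erase u}) +
          #(linkIn F (X.erase u) u (l + 2) ∪ linkIn F (X.erase u) v (l + 2)) := by
        exact_mod_cast hle
      rcases le_total (#(linkIn F (X.erase u) v (l + 2))) (#(linkIn F (X.erase u) u (l + 2)))
        with h | h
      · exact S.le_card_shadow_of_two_centres hF hZ hu hv huv.symm hcard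
          (hdiv _ (by rw [hX', hX])) (by linarith) h
      · refine S.le_card_shadow_of_two_centres hF hZ hv hu huv hcard
          (hdiv _ (by rw [card_insert_of_notMem hv, hZ])) ?_ h
        rw [union_comm]
        linarith
    · have hVX' : ∀ v ∈ V, v ≠ max' V hV → v ∈ X := by
        intro v hv hvmax
        by_contra hvX
        obtain ⟨X₂, hX₂, h⟩ := exists_card_filter_compression_subset_le hU hV hd hUVc hlt hU2
          hmin' hT hTX hTF hv hvmax hvX
        exact h.not_gt (hin X₂ (hX₂.trans hX))
      have hvmin := hVX' _ (min'_mem V hV) (min'_lt_max'_of_card V (hUVc ▸ hU2)).ne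
      have hnew := card_filter_subset_notMem_le (m := l + i + 2) (r := l + 1) hX hC hd hU2
        (min'_mem V hV) hvmin
      have hsplit : #({R ∈ UV.compression U V F | R ⊆ X}) ≤
          #({R ∈ F | R ⊆ X}) + #({R ∈ UV.compression U V F | R ⊆ X ∧ R ∉ F}) := by
        refine (card_le_card fun R hR => ?_).trans (card_union_le _ _)
        rw [mem_filter] at hR
        rw [mem_union, mem_filter, mem_filter]
        by_cases h : R ∈ F
        · exact Or.inl ⟨h, hR.2⟩
        · exact Or.inr ⟨hR.1, hR.2, h⟩
      -- At most b members entered `X`; so fewer than b + q ≤ p members of `F` lie outside it, and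
      -- more than C(n-1,k) + c + b inside.
      have hinX : (#({R ∈ UV.compression U V F | R ⊆ X}) : ℝ) ≤ #({R ∈ F | R ⊆ X}) + S.b := by
        rw [S.hb]
        exact_mod_cast hsplit.trans (Nat.add_le_add_left hnew _)
      have hFs : (#({R ∈ F | R ⊆ X}) : ℝ) + #({R ∈ F | ¬ R ⊆ X}) = #F := by
        exact_mod_cast card_filter_add_card_filter_not (s := F) (· ⊆ X)
      have := S.hp
      have := S.hq
      have := S.hb_pos
      exact S.le_card_shadow_of_inside hF hX hcard (by linarith) (hdiv X hX)
        (Or.inl (by linarith))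

end Finset

/-! ### Transfer to a finite linearly ordered ground set, and conclusion. -/

namespace Finset

open scoped FinsetFamily

/-- A finite family admits a copy over some `Fin N`. -/
lemma exists_fin_copy {α : Type*} [DecidableEq α] {k : ℕ} {F : Finset (Finset α)}
    (hF : (F : Set (Finset α)).Sized k) (X₀ : Finset α) :
    ∃ (N : ℕ) (φ : Fin N ↪ α) (G : Finset (Finset (Fin N))), #X₀ ≤ N ∧
      (G : Set (Finset (Fin N))).Sized k ∧ #F ≤ #G ∧ #(∂ G) ≤ #(∂ F) ∧
      ∀ X : Finset (Fin N),
        #(F \ (X.map φ).powersetCard k) ≤ #({R ∈ G | ¬ R ⊆ X}) := by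
  set T := X₀ ∪ F.sup id with hT
  set φ : Fin #T ↪ α := T.equivFin.symm.toEmbedding.trans (Function.Embedding.subtype _) with hφ
  set G : Finset (Finset (Fin #T)) := {A | A.map φ ∈ F} with hG
  have hmem : ∀ A, A ∈ G ↔ A.map φ ∈ F := fun A => by rw [hG, mem_filter]; simp
  have hsurj : ∀ R ∈ F, ∃ A ∈ G, A.map φ = R := by
    intro R hR
    have hRT : ∀ a ∈ R, ∃ t, φ t = a := fun a ha => by
      have haT : a ∈ T := mem_union_right _ (mem_sup.2 ⟨R, hR, ha⟩)
      exact ⟨T.equivFin ⟨a, haT⟩, by simp [hφ]⟩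
    have hm : ({t | φ t ∈ R} : Finset (Fin #T)).map φ = R := by
      ext a
      simp only [mem_map, mem_filter, mem_univ, true_and]
      constructor
      · rintro ⟨t, ht, rfl⟩
        exact ht
      · intro ha
        obtain ⟨t, rfl⟩ := hRT a ha
        exact ⟨t, ha, rfl⟩
    exact ⟨_, (hmem _).2 (hm.symm ▸ hR), hm⟩
  refine ⟨#T, φ, G, card_le_card subset_union_left, ?_, ?_, ?_, ?_⟩
  · intro A hA
    rw [← card_map φ]
    exact hF ((hmem A).1 hA)
  · refine (card_le_card fun R hR => ?_).trans (card_image_le (f := Finset.map φ))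
    exact mem_image.2 (hsurj R hR)
  · refine card_le_card_of_injOn (Finset.map φ) (fun A hA => ?_) (map_injective φ).injOn
    obtain ⟨a, ha, hAG⟩ := mem_shadow_iff_insert_mem.1 hA
    rw [hmem, map_insert] at hAG
    exact mem_shadow_iff_insert_mem.2 ⟨φ a, by simpa using ha, hAG⟩
  · intro X
    refine (card_le_card fun R hR => ?_).trans (card_image_le (f := Finset.map φ))
    rw [mem_sdiff] at hR
    obtain ⟨A, hA, rfl⟩ := hsurj R hR.1
    refine mem_image.2 ⟨A, mem_filter.2 ⟨hA, fun h => hR.2 ?_⟩, rfl⟩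
    exact mem_powersetCard.2 ⟨map_subset_map.2 h, hF hR.1⟩

end Finset

theorem mainTheorem2 {α : Type*} [DecidableEq α] (n k : ℕ) (hk : 0 < k) (hkn : k < n)
    (F : Finset (Finset α)) (hF : (F : Set (Finset α)).Sized k) (x y : ℝ)
    (hx₁ : (k : ℝ) - 1 ≤ x) (hx₂ : x ≤ (n : ℝ) - 3)
    (hy₁ : (n : ℝ) - k ≤ y) (hy₂ : y ≤ (n : ℝ) - 3)
    (hcard : (n.choose k : ℝ) - Ring.choose y (n - k) + Ring.choose x (k - 1) ≤ (F.card : ℝ))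
    (hdiv : Ring.choose x (k - 1) ≤ (kruskalKatonaDiversity k F n : ℝ)) :
    (n.choose (k - 1) : ℝ) - Ring.choose y (n - k + 1) + Ring.choose x (k - 2)
      ≤ (F.shadow.card : ℝ) := by
  have hk3 : 3 ≤ k := by
    have : (3 : ℝ) ≤ k := by linarith
    exact_mod_cast this
  have hkn2 : k + 2 ≤ n := by
    have : (k : ℝ) + 2 ≤ n := by linarith
    exact_mod_cast this
  obtain ⟨l, rfl⟩ := Nat.exists_eq_add_of_le' hk3
  obtain ⟨i, rfl⟩ : ∃ i, n = l + i + 5 := ⟨n - (l + 5), by omega⟩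
  rw [show l + i + 5 - (l + 3) = i + 2 by omega] at hcard ⊢
  rw [show l + 3 - 1 = l + 2 by omega] at hcard hdiv ⊢
  rw [show l + 3 - 2 = l + 1 by omega]
  push_cast at hx₁ hx₂ hy₁ hy₂
  have hqpos : 0 < Ring.choose x (l + 2) :=
    Ring.real_choose_pos (by push_cast; linarith)
  have hpos : 0 < kruskalKatonaDiversity (l + 3) F (l + i + 5) := by
    exact_mod_cast hqpos.trans_le hdiv
  -- The infimum of the empty set is 0, so positive diversity provides an n-set; including it in the
  -- copy ensures n ≤ N.
  obtain ⟨_, X₀, hX₀, -⟩ := Nat.nonempty_of_pos_sInf hpos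
  obtain ⟨N, φ, G, hN, hG, hFG, hsh, hX⟩ := Finset.exists_fin_copy hF X₀
  rw [hX₀] at hN
  obtain ⟨S, hq, hL, hp, hD⟩ := Finset.exists_shadowProfile (N := N) (x := x) (y := y) hN
    (by linarith) (by linarith) (by linarith) (by linarith)
  have e1 : ((l + i + 5).choose (l + 3) : ℝ) =
      (l + i + 4).choose (l + 2) + (l + i + 4).choose (l + 3) := by
    exact_mod_cast Nat.choose_succ_succ (l + i + 4) (l + 2)
  have e2 : ((l + i + 5).choose (l + 2) : ℝ) =
      (l + i + 4).choose (l + 1) + (l + i + 4).choose (l + 2) := by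
    exact_mod_cast Nat.choose_succ_succ (l + i + 4) (l + 1)
  have hFG' : (F.card : ℝ) ≤ G.card := by exact_mod_cast hFG
  have key := S.le_card_shadow hN hG (by rw [hp, hq]; linarith) (fun X hXc => by
    rw [hq]
    refine hdiv.trans ?_
    have h1 : kruskalKatonaDiversity (l + 3) F (l + i + 5) ≤
        (F \ (X.map φ).powersetCard (l + 3)).card :=
      Nat.sInf_le ⟨X.map φ, by rw [Finset.card_map, hXc], rfl⟩
    exact_mod_cast h1.trans (hX X))
  have hsh' : (G.shadow.card : ℝ) ≤ F.shadow.card := by exact_mod_cast hsh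
  rw [hD, hL] at key
  rw [e2]
  linarith
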